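/- **Setting.** A *game of length $H\ge 1$* is a finite, episodic, two-player zero-sum game with imperfect information and perfect recall. There is a finite state space, partitioned into information sets $x\in\mathcal X$ of the max-player and into information sets $y\in\mathcal Y$ of the min-player, with finite non-empty action sets $\mathcal A(x)$, $\mathcal B(y)$; there are an initial state distribution, transition kernels, and deterministic rewards $r_h(s,a,b)\in[0,1]$ that the min-player pays to the max-player. Perfect recall means that every information set belongs to a single step $h\in\{1,\dots,H\}$ and has a unique history $(x_1,a_1,\dots,x_h=x)$, and similarly for the min-player. Put $X=|\mathcal X|$, $Y=|\mathcal Y|$, $A_{\mathcal X}=\sum_{x}|\mathcal A(x)|$, $B_{\mathcal Y}=\sum_y|\mathcal B(y)|$. Let $V^{\mu,\nu}$ be the expected total reward of an episode when the players use the (behavioural) policies $\mu,\nu$. The profile $(\mu,\nu)$ is an $\varepsilon$-Nash equilibrium if $V^{\mu',\nu}-V^{\mu,\nu}\le\varepsilon$ and $V^{\mu,\nu}-V^{\mu,\nu'}\le\varepsilon$ for all policies $\mu',\nu'$. An algorithm that controls the max-player (respectively both players) knows the information-set structure of the player (players) it controls and chooses, for each episode $t$, a policy $\mu^t$ (a profile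 $(\mu^t,\nu^t)$) as a function of the information sets, actions and rewards that the controlled players observed in the earlier episodes; an algorithm that controls both players outputs after $T$ episodes the profile $(\mu^{T+1},\nu^{T+1})$ computed in the same way from all $T$ episodes. The regret of the max-player is $R_T=\max_{\mu'}\sum_{t=1}^T\big(V^{\mu',\nu^t}-V^{\mu^t,\nu^t}\big)$. **Theorem.** Write $\ell=\log(1/(4\delta))$, $m_H(n)=(n-H)\min\{n-H,H\}$ and, for $A\ge2$, $g_H(A)=1+A+\dots+A^{H-1}=\frac{A^H-1}{A-1}$. Every game of length $H$ has $A_{\mathcal X}\ge H$ and $B_{\mathcal Y}\ge H$; if all information sets of the max-player (of the min-player) have the same number $A\ge2$ of actions, then $X\ge g_H(A)$ (then $Y\ge g_H(A)$). Moreover, there is an absolute constant $c>0$ such that the following hold for every $H\ge1$ and every $\delta\in(0,1/4)$. 1. (Regret, variable action-set sizes.) Let $n\ge H$ and $T\ge 0.4\,\lfloor n/H\rfloor\,\ell$. For every algorithm that controls the max-player there is a game of length $H$ with $A_{\mathcal X}=n$ such that, whatever policies the min-player selects (possibly depending on the past episodes), with probability greater than $\delta$ $$R_T\ \ge\ c\,\sqrt{m_H(n)\,T\,\ell}.$$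 In particular, the regret is $\Omega(\sqrt{H A_{\mathcal X}T\ell})$ when $A_{\mathcal X}\ge 2H$. 2. (Sample complexity, variable action-set sizes.) Let $n,k\ge H$ and $0<\varepsilon\le\frac18\min\{\max(n,k)-H,\,H\}$. For every $T$ and every algorithm that controls both players there is a game of length $H$ with $A_{\mathcal X}=n$ and $B_{\mathcal Y}=k$ such that, if the profile that the algorithm outputs after $T$ episodes is an $\varepsilon$-Nash equilibrium with probability at least $1-\delta$, then $$T\ \ge\ c\,\frac{m_H(n)+m_H(k)}{\varepsilon^2}\,\ell .$$ In particular, $\Omega(H(A_{\mathcal X}+B_{\mathcal Y})\ell/\varepsilon^2)$ episodes are needed when $A_{\mathcal X},B_{\mathcal Y}\ge2H$. 3. (Regret, fixed action-set size.) Let $A\ge2$, $g_H(A)\le X<2g_H(A)$ and $T\ge0.4\cdot2A^H\,\ell$. For every algorithm that controls the max-player there is a game of length $H$ in which the max-player has $X$ information sets with $A$ actions each (so $A_{\mathcal X}=AX$) such that, whatever policies the min-player selects (possibly depending on the past episodes), with probability greater than $\delta$ $$R_T\ \ge\ c\,\sqrt{A_{\mathcal X}\,T\,\ell}.$$ 4.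 (Sample complexity, fixed action-set sizes.) Let $A,B\ge2$, $g_H(A)\le X<2g_H(A)$, $g_H(B)\le Y<2g_H(B)$ and $0<\varepsilon\le\frac18$. For every $T$ and every algorithm that controls both players there is a game of length $H$ in which the max-player has $X$ information sets with $A$ actions each and the min-player has $Y$ information sets with $B$ actions each such that, if the profile that the algorithm outputs after $T$ episodes is an $\varepsilon$-Nash equilibrium with probability at least $1-\delta$, then $$T\ \ge\ c\,\frac{A_{\mathcal X}+B_{\mathcal Y}}{\varepsilon^2}\,\ell .$$ -/

import Mathlib

noncomputable section

/-- The information-set structure of one player with perfect recall, for a game of length `H`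
(steps are numbered `0, …, H - 1`). Every information set has a unique history: it is either an
initial one (step `0`), or it is reached from a unique pair (information set, action) of the
previous step. -/
structure InfoTree (H : ℕ) where
  /-- information sets -/
  Node : Type
  [nodeFintype : Fintype Node]
  /-- the actions available at an information set -/
  Act : Node → Type
  [actFintype : ∀ x, Fintype (Act x)]
  [actNonempty : ∀ x, Nonempty (Act x)]
  /-- the step at which the information set occurs -/
  depth : Node → ℕ
  depth_lt : ∀ x, depth x < H
  /-- the last pair (information set, action) in the history of an information set -/
  parent : Node → Option (Σ x, Act x)
  depth_root : ∀ x, parent x = none → depth x = 0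
  depth_child : ∀ x p, parent x = some p → depth x = depth p.1 + 1

attribute [instance] InfoTree.nodeFintype InfoTree.actFintype InfoTree.actNonempty

/-- The number of information sets of a player. -/
def InfoTree.numInfoSets {H : ℕ} (I : InfoTree H) : ℕ := Fintype.card I.Node

/-- The total number of actions of a player, summed over the information sets. -/
def InfoTree.numActions {H : ℕ} (I : InfoTree H) : ℕ := ∑ x, Fintype.card (I.Act x)

/-- Every information set has exactly `A` actions. -/
def InfoTree.HasFixedSize {H : ℕ} (I : InfoTree H) (A : ℕ) : Prop :=
  ∀ x, Fintype.card (I.Act x) = A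

/-- A (behavioural) policy: a probability distribution over the actions at each
information set. -/
abbrev InfoTree.Policy {H : ℕ} (I : InfoTree H) : Type := (x : I.Node) → stdSimplex ℝ (I.Act x)

/-- A finite episodic two-player zero-sum game of length `H` with imperfect information and
perfect recall, in which `I` and `J` are the information-set structures of the max-player and of
the min-player. As each information set belongs to one step only, so does each state, and
transitions and rewards need no extra dependence on the step. -/
structure Game {H : ℕ} (I J : InfoTree H) where
  State : Type
  [stateFintype : Fintype State]
  /-- the information set of the max-player that contains a state -/
  infoX : State → I.Node
  /-- the information set of the min-player that contains a state -/
  infoY : State → J.Node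
  infoX_surjective : Function.Surjective infoX
  infoY_surjective : Function.Surjective infoY
  depth_eq : ∀ s, I.depth (infoX s) = J.depth (infoY s)
  /-- initial state distribution -/
  init : stdSimplex ℝ State
  init_support : ∀ s, init s ≠ 0 → I.depth (infoX s) = 0
  /-- state transition kernel (never used at states of the last step) -/
  trans : (s : State) → I.Act (infoX s) → J.Act (infoY s) → stdSimplex ℝ State
  trans_support : ∀ s a b s', I.depth (infoX s) + 1 < H → trans s a b s' ≠ 0 →
    I.parent (infoX s') = some ⟨infoX s, a⟩ ∧ J.parent (infoY s') = some ⟨infoY s, b⟩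
  /-- reward received by the max-player and paid by the min-player -/
  reward : (s : State) → I.Act (infoX s) → J.Act (infoY s) → ℝ
  reward_mem : ∀ s a b, reward s a b ∈ Set.Icc (0 : ℝ) 1

attribute [instance] Game.stateFintype

namespace Game

variable {H : ℕ} {I J : InfoTree H} (G : Game I J)

/-- What happens at one step of an episode: the state and the actions of the two players. -/
abbrev Step : Type := Σ s : G.State, I.Act (G.infoX s) × J.Act (G.infoY s)

/-- An episode. -/
abbrev Traj : Type := Fin H → G.Step

/-- The reward of one step. -/
def stepReward (z : G.Step) : ℝ := G.reward z.1 z.2.1 z.2.2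

/-- The probability of an episode when the players use the policies `μ` and `ν`. -/
def trajProb [NeZero H] (μ : I.Policy) (ν : J.Policy) (τ : G.Traj) : ℝ :=
  G.init (τ 0).1 *
    (∏ h : Fin H, μ (G.infoX (τ h).1) (τ h).2.1 * ν (G.infoY (τ h).1) (τ h).2.2) *
    ∏ h : Fin H, if hh : h.1 + 1 < H then
      G.trans (τ h).1 (τ h).2.1 (τ h).2.2 (τ ⟨h.1 + 1, hh⟩).1 else 1

/-- The expected total reward of the max-player in one episode. -/
def value [NeZero H] (μ : I.Policy) (ν : J.Policy) : ℝ :=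
  ∑ τ : G.Traj, G.trajProb μ ν τ * ∑ h : Fin H, G.stepReward (τ h)

/-- `(μ, ν)` is an `ε`-Nash equilibrium: no player gains more than `ε` by deviating alone. -/
def IsEpsNash [NeZero H] (ε : ℝ) (μ : I.Policy) (ν : J.Policy) : Prop :=
  (∀ μ' : I.Policy, G.value μ' ν - G.value μ ν ≤ ε) ∧
  (∀ ν' : J.Policy, G.value μ ν - G.value μ ν' ≤ ε)

/-- A rule that selects a policy for each episode, given the past episodes. Episodes are
numbered from `0`: the rule selects the policy for episode `t` from the episodes `u < t`. -/
abbrev Rule (K : InfoTree H) : Type := (t : ℕ) → (Fin t → G.Traj) → K.Policy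

/-- The episodes before episode `t`. -/
def past {T : ℕ} (ω : Fin T → G.Traj) (t : Fin T) : Fin t.1 → G.Traj :=
  fun u => ω ⟨u.1, u.2.trans t.2⟩

/-- The joint probability of `T` consecutive episodes when the policies of each episode are
selected by the rules `M` and `N` from the past episodes. -/
def playProb [NeZero H] (M : G.Rule I) (N : G.Rule J) {T : ℕ} (ω : Fin T → G.Traj) : ℝ :=
  ∏ t : Fin T, G.trajProb (M t.1 (G.past ω t)) (N t.1 (G.past ω t)) (ω t)

open Classical in
/-- The probability of an event that depends on the first `T` episodes. -/
def prob [NeZero H] (M : G.Rule I) (N : G.Rule J) (T : ℕ) (E : (Fin T → G.Traj) → Prop) : ℝ :=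
  ∑ ω : Fin T → G.Traj, if E ω then G.playProb M N ω else 0

/-- The regret of the max-player after the `T` episodes `ω`: the supremum over fixed policies
`μ'` of the sum over `t` of the differences of values against the policy of the min-player. -/
def regretMax [NeZero H] (M : G.Rule I) (N : G.Rule J) {T : ℕ} (ω : Fin T → G.Traj) : ℝ :=
  ⨆ μ' : I.Policy, ∑ t : Fin T,
    (G.value μ' (N t.1 (G.past ω t)) - G.value (M t.1 (G.past ω t)) (N t.1 (G.past ω t)))

/-- What the max-player observes of an episode: its information sets, actions and rewards. -/
def obsMax (τ : G.Traj) : Fin H → (Σ x, I.Act x) × ℝ :=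
  fun h => (⟨G.infoX (τ h).1, (τ h).2.1⟩, G.stepReward (τ h))

/-- What the two players together observe of an episode. -/
def obsBoth (τ : G.Traj) : Fin H → (Σ x, I.Act x) × (Σ y, J.Act y) × ℝ :=
  fun h => (⟨G.infoX (τ h).1, (τ h).2.1⟩, ⟨G.infoY (τ h).1, (τ h).2.2⟩, G.stepReward (τ h))

end Game

/-- An algorithm that controls the max-player in games of length `H`. It may depend on the
information-set structure of the max-player; the policy for episode `t` is a function of the
observations of the max-player in the episodes `u < t`. -/
abbrev MaxAlgorithm (H : ℕ) : Type 1 :=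
  (I : InfoTree H) → (t : ℕ) → (Fin t → Fin H → (Σ x, I.Act x) × ℝ) → I.Policy

/-- An algorithm that controls both players in games of length `H`. It may depend on the
information-set structures; the policies for episode `t` are a function of the observations
of both players in the episodes `u < t`. After `T` episodes, its output is the profile that it
computes from the observations in all of them. -/
abbrev JointAlgorithm (H : ℕ) : Type 1 :=
  (I J : InfoTree H) → (t : ℕ) →
    (Fin t → Fin H → (Σ x, I.Act x) × (Σ y, J.Act y) × ℝ) → I.Policy × J.Policy

/-- The way a max-player algorithm plays a given game. -/
abbrev MaxAlgorithm.rule {H : ℕ} (L : MaxAlgorithm H) {I J : InfoTree H} (G : Game I J) : G.Rule I :=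
  fun t past => L I t fun u => G.obsMax (past u)

/-- The profile that a joint algorithm computes after `t` episodes of a given game. -/
def JointAlgorithm.profile {H : ℕ} (L : JointAlgorithm H) {I J : InfoTree H} (G : Game I J)
    (t : ℕ) (past : Fin t → G.Traj) : I.Policy × J.Policy :=
  L I J t fun u => G.obsBoth (past u)

/-- The probability that the profile which a joint algorithm outputs after `T` episodes of the
game `G` is an `ε`-Nash equilibrium. -/
def JointAlgorithm.successProb {H : ℕ} [NeZero H] (L : JointAlgorithm H) {I J : InfoTree H}
    (G : Game I J) (T : ℕ) (ε : ℝ) : ℝ :=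
  G.prob (fun t past => (L.profile G t past).1) (fun t past => (L.profile G t past).2) T
    fun ω => G.IsEpsNash ε (L.profile G T ω).1 (L.profile G T ω).2

/-- `1 + A + ⋯ + A ^ (H - 1)`, which is `(A ^ H - 1) / (A - 1)` when `A ≥ 2`. -/
def treeSize (A H : ℕ) : ℕ := ∑ h ∈ Finset.range H, A ^ h

/-- `(n - H) * min (n - H) H`, where `n` is the total number of actions of a player. -/
def effSize (n H : ℕ) : ℝ := ((n : ℝ) - H) * min ((n : ℝ) - H) H

end

/-! The bounds come from a bandit hidden in the tree of one player. A sequence of choices of that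
player (a plan) is an arm, and there are `K` of them. Nature draws one hidden bit per episode, with
bias `gap`, and moves information sets deterministically. From step `start` on every reward of the
episode is the same function of the arm and the bit, so an episode reveals at most one biased bit,
while its stakes are `d = H - start` times those of a single reward.

With `sign = 1`, the base arm always pays `1/2`, an ordinary arm has mean `1/2 - gap`, and the
special arm, if there is one, reads the bit with the opposite sign and has mean `1/2 + gap`. The
base arm is therefore optimal when no arm is special, and the special arm is optimal otherwise. With
`sign = -1` the same family serves the min-player.

The games differ only in their reward functions. Flipping the bit in the episodes whose arm is `i`
(`switch`) is a permutation of the episodes that preserves all observations between the game `none`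
and the game `some i` (`obsMax_switch`, `obsBoth_switch`). It multiplies the probability by an
explicit likelihood ratio (`law_switch`, `playProb_switch`). The divergence is at most `32 * gap ^
2` times the expected number of plays of `i` (`sum_playProb_mul_logRatio`, `information_le`), and
some `i` is played at most `T / (K - 1)` times on average. The Bretagnolle–Huber inequality then
gives `exists_lt_prob`: when `gap ^ 2 * T` is small against `K * ℓ`, an event that must occur in one
of the two games has probability above `δ` in one of them. The event is large regret, or failure to
be an equilibrium: playing the base arm half of the time is bad in `some i`, and playing it less is
bad in `none`.

It remains to choose trees. With variable sizes only step `s = start` has a choice, among `K`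
actions, and `K * d ^ 2` is of the order of `effSize`. With fixed size `A` every sequence of `A ^ H`
is an arm and only the last step is rewarded, so `d = 1`. Unreachable information sets at the last
step adjust the counts. In the regret bounds the min-player has a single policy; in the sample
bounds the player with more arms or actions carries the bandit and the other player has no
influence. -/

noncomputable section

/-! ### Finite-horizon sequential laws -/

/-- The probability of the sequence `ω` when the `t`-th term is drawn from a kernel that depends
on the previous terms. -/
def seqProb {Ω : Type} (q : (t : ℕ) → (Fin t → Ω) → Ω → ℝ) (T : ℕ) (ω : Fin T → Ω) : ℝ :=
  ∏ t : Fin T, q t.1 (fun u => ω ⟨u.1, u.2.trans t.2⟩) (ω t)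

section SeqProb

variable {Ω : Type} (q : (t : ℕ) → (Fin t → Ω) → Ω → ℝ)

lemma seqProb_snoc (T : ℕ) (ω : Fin T → Ω) (x : Ω) :
    seqProb q (T + 1) (Fin.snoc (α := fun _ => Ω) ω x) = seqProb q T ω * q T ω x := by
  have key : ∀ u : Fin T, (Fin.snoc (α := fun _ => Ω) ω x : Fin (T + 1) → Ω)
      ⟨u.1, u.2.trans (Nat.lt_succ_self T)⟩ = ω u := fun u =>
    Fin.snoc_castSucc (α := fun _ => Ω) x ω u
  unfold seqProb
  rw [Fin.prod_univ_castSucc]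
  congr 1
  · refine Finset.prod_congr rfl fun t _ => ?_
    rw [Fin.snoc_castSucc]
    congr 1
    funext u
    exact key ⟨u.1, u.2.trans t.2⟩
  · rw [Fin.snoc_last]
    congr 1
    funext u
    exact key u

lemma sum_fin_succ_fun [Fintype Ω] {T : ℕ} (f : (Fin (T + 1) → Ω) → ℝ) :
    ∑ ω, f ω = ∑ ω : Fin T → Ω, ∑ x, f (Fin.snoc (α := fun _ => Ω) ω x) := by
  rw [← (Fin.snocEquiv fun _ => Ω).sum_comp, Fintype.sum_prod_type, Finset.sum_comm]
  rfl

variable {q}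

lemma sum_seqProb [Fintype Ω] (hq : ∀ t h, ∑ x, q t h x = 1) (T : ℕ) :
    ∑ ω, seqProb q T ω = 1 := by
  induction T with
  | zero => simp [seqProb]
  | succ T ih => simp_rw [sum_fin_succ_fun, seqProb_snoc, ← Finset.mul_sum, hq, mul_one, ih]

/-- A function whose conditional means all vanish has mean zero along the sequence. -/
lemma sum_seqProb_mul_sum_eq_zero [Fintype Ω] (hq : ∀ t h, ∑ x, q t h x = 1) (g : Ω → ℝ)
    (hg : ∀ t h, ∑ x, q t h x * g x = 0) (T : ℕ) :
    ∑ ω, seqProb q T ω * ∑ t, g (ω t) = 0 := by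
  induction T with
  | zero => simp
  | succ T ih =>
    rw [sum_fin_succ_fun, ← ih]
    refine Finset.sum_congr rfl fun ω _ => ?_
    simp_rw [seqProb_snoc, Fin.sum_univ_castSucc, Fin.snoc_castSucc, Fin.snoc_last, mul_add,
      Finset.sum_add_distrib, mul_assoc, ← Finset.mul_sum, hg, ← Finset.sum_mul, hq]
    ring

end SeqProb

/-- A Markov chain has total mass one. -/
lemma sum_markov_chain {S : Type} [Fintype S] (f : S → ℝ) (k : S → S → ℝ) (hf : ∑ z, f z = 1)
    (hk : ∀ z, ∑ z', k z z' = 1) (m : ℕ) :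
    ∑ τ : Fin (m + 1) → S, f (τ 0) * ∏ i : Fin m, k (τ i.castSucc) (τ i.succ) = 1 := by
  induction m with
  | zero =>
    rw [← hf, ← (Equiv.funUnique (Fin 1) S).sum_comp]
    simp
  | succ m ih =>
    rw [sum_fin_succ_fun, ← ih]
    refine Finset.sum_congr rfl fun τ _ => ?_
    have h0 : ∀ x : S, (Fin.snoc (α := fun _ => S) τ x : Fin (m + 2) → S) 0 = τ 0 := fun x =>
      Fin.snoc_castSucc (α := fun _ => S) x τ 0
    have h1 : ∀ (x : S) (i : Fin m),
        (Fin.snoc (α := fun _ => S) τ x : Fin (m + 2) → S) i.castSucc.succ = τ i.succ :=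
      fun x i => Fin.snoc_castSucc (α := fun _ => S) x τ i.succ
    simp_rw [Fin.prod_univ_castSucc, h0, h1, Fin.snoc_castSucc, Fin.succ_last, Fin.snoc_last,
      ← mul_assoc, ← Finset.mul_sum, hk, mul_one]

/-- The Bretagnolle–Huber inequality for two laws with log-likelihood ratio `Λ`. -/
lemma half_exp_neg_le_sum_add_sum {α : Type} [Fintype α] (p Λ : α → ℝ) (hp : ∀ x, 0 ≤ p x)
    (hp1 : ∑ x, p x = 1) (hr1 : ∑ x, p x * Real.exp (-Λ x) = 1) (B : ℝ)
    (hB : ∑ x, p x * Λ x ≤ B) (E : α → Prop) [DecidablePred E] :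
    Real.exp (-B) / 2 ≤
      ∑ x, ((if E x then p x else 0) + if E x then 0 else p x * Real.exp (-Λ x)) := by
  have hr : ∀ x, 0 ≤ p x * Real.exp (-Λ x) := fun x => mul_nonneg (hp x) (Real.exp_nonneg _)
  set a := ∑ x with E x, p x with ha
  set b := ∑ x with ¬ E x, p x * Real.exp (-Λ x) with hb
  have hab : ∑ x, ((if E x then p x else 0) + if E x then 0 else p x * Real.exp (-Λ x)) =
      a + b := by
    rw [Finset.sum_add_distrib, ha, hb, Finset.sum_filter, Finset.sum_filter]
    simp [ite_not]
  have hexp : ∀ x, p x * Real.exp (-Λ x / 2) = √(p x) * √(p x * Real.exp (-Λ x)) := fun x => by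
    rw [Real.sqrt_mul (hp x), ← mul_assoc, Real.mul_self_sqrt (hp x), Real.exp_half]
  -- Jensen's inequality for `exp`, proved by the tangent line at `-B / 2`; the Cauchy–Schwarz
  -- inequality on the event and on its complement then bounds the same affinity from above.
  have hlow : Real.exp (-B / 2) ≤ ∑ x, p x * Real.exp (-Λ x / 2) := by
    have hx : ∀ x, Real.exp (-B / 2) * (p x * (1 + B / 2) - p x * Λ x / 2) ≤
        p x * Real.exp (-Λ x / 2) := fun x => by
      have h1 := Real.add_one_le_exp (-Λ x / 2 + B / 2)
      have h2 : Real.exp (-Λ x / 2) = Real.exp (-B / 2) * Real.exp (-Λ x / 2 + B / 2) := by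
        rw [← Real.exp_add]; ring_nf
      rw [h2]
      have h3 := mul_le_mul_of_nonneg_left h1 (mul_nonneg (Real.exp_nonneg (-B / 2)) (hp x))
      nlinarith
    refine le_trans ?_ (Finset.sum_le_sum fun x _ => hx x)
    rw [← Finset.mul_sum, Finset.sum_sub_distrib, ← Finset.sum_mul, hp1, ← Finset.sum_div]
    have := Real.exp_pos (-B / 2)
    nlinarith
  have hE : ∑ x with E x, p x * Real.exp (-Λ x / 2) ≤ √a := by
    calc _ = ∑ x with E x, √(p x) * √(p x * Real.exp (-Λ x)) :=
          Finset.sum_congr rfl fun x _ => hexp x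
      _ ≤ √a * √(∑ x with E x, p x * Real.exp (-Λ x)) :=
          Real.sum_sqrt_mul_sqrt_le _ (fun x => hp x) fun x => hr x
      _ ≤ √a * 1 := by
          refine mul_le_mul_of_nonneg_left (Real.sqrt_le_one.2 ?_) (Real.sqrt_nonneg _)
          rw [← hr1]
          exact Finset.sum_le_univ_sum_of_nonneg hr
      _ = √a := mul_one _
  have hEc : ∑ x with ¬ E x, p x * Real.exp (-Λ x / 2) ≤ √b := by
    calc _ = ∑ x with ¬ E x, √(p x) * √(p x * Real.exp (-Λ x)) :=
          Finset.sum_congr rfl fun x _ => hexp x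
      _ ≤ √(∑ x with ¬ E x, p x) * √b :=
          Real.sum_sqrt_mul_sqrt_le _ (fun x => hp x) fun x => hr x
      _ ≤ 1 * √b := by
          refine mul_le_mul_of_nonneg_right (Real.sqrt_le_one.2 ?_) (Real.sqrt_nonneg _)
          rw [← hp1]
          exact Finset.sum_le_univ_sum_of_nonneg hp
      _ = √b := one_mul _
  have ha0 : 0 ≤ a := Finset.sum_nonneg fun x _ => hp x
  have hb0 : 0 ≤ b := Finset.sum_nonneg fun x _ => hr x
  have hsum : Real.exp (-B / 2) ≤ √a + √b := by
    refine hlow.trans ?_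
    rw [← Finset.sum_filter_add_sum_filter_not _ E]
    exact add_le_add hE hEc
  have hsq : Real.exp (-B) = Real.exp (-B / 2) ^ 2 := by
    rw [← Real.exp_nat_mul]; ring_nf
  rw [hab, hsq]
  have := Real.exp_pos (-B / 2)
  have h1 := Real.sq_sqrt ha0
  have h2 := Real.sq_sqrt hb0
  nlinarith [sq_nonneg (√a - √b), pow_le_pow_left₀ this.le hsum 2]

/-! ### General facts about games -/

namespace Game

variable {H : ℕ} {I J : InfoTree H} (G : Game I J)

/-- The probability that the players choose the actions of a step, given its state. -/
def stepWeight (μ : I.Policy) (ν : J.Policy) (z : G.Step) : ℝ :=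
  μ (G.infoX z.1) z.2.1 * ν (G.infoY z.1) z.2.2

lemma stepWeight_nonneg (μ : I.Policy) (ν : J.Policy) (z : G.Step) : 0 ≤ G.stepWeight μ ν z :=
  mul_nonneg ((μ _).2.1 _) ((ν _).2.1 _)

lemma sum_stepWeight (f : G.State → ℝ) (μ : I.Policy) (ν : J.Policy) :
    ∑ z : G.Step, f z.1 * G.stepWeight μ ν z = ∑ s, f s := by
  rw [Fintype.sum_sigma]
  refine Finset.sum_congr rfl fun s _ => ?_
  have h1 : ∑ a, μ (G.infoX s) a = 1 := (μ _).2.2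
  have h2 : ∑ b, ν (G.infoY s) b = 1 := (ν _).2.2
  calc ∑ p : I.Act (G.infoX s) × J.Act (G.infoY s), f s * (μ (G.infoX s) p.1 * ν (G.infoY s) p.2)
      = f s * ((∑ a, μ (G.infoX s) a) * ∑ b, ν (G.infoY s) b) := by
        rw [← Finset.mul_sum, Fintype.sum_mul_sum, Fintype.sum_prod_type]
    _ = f s := by rw [h1, h2, mul_one, mul_one]

lemma trajProb_nonneg [NeZero H] (μ : I.Policy) (ν : J.Policy) (τ : G.Traj) :
    0 ≤ G.trajProb μ ν τ := by
  refine mul_nonneg (mul_nonneg (G.init.2.1 _) ?_) ?_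
  · exact Finset.prod_nonneg fun h _ => G.stepWeight_nonneg μ ν (τ h)
  · refine Finset.prod_nonneg fun h _ => ?_
    split_ifs
    · exact (G.trans _ _ _).2.1 _
    · exact zero_le_one

/-- An episode is a Markov chain on steps: the kernel draws the next state and then both actions
there. -/
lemma sum_trajProb [NeZero H] (μ : I.Policy) (ν : J.Policy) : ∑ τ, G.trajProb μ ν τ = 1 := by
  obtain _ | m := H
  · exact absurd rfl (NeZero.ne 0)
  have := sum_markov_chain (fun z : G.Step => G.init z.1 * G.stepWeight μ ν z)
    (fun z z' => G.trans z.1 z.2.1 z.2.2 z'.1 * G.stepWeight μ ν z')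
    (by rw [G.sum_stepWeight]; exact G.init.2.2)
    (fun z => by
      rw [G.sum_stepWeight (fun s => G.trans z.1 z.2.1 z.2.2 s)]
      exact (G.trans _ _ _).2.2) m
  rw [← this]
  refine Finset.sum_congr rfl fun τ _ => ?_
  have h1 : ∏ h : Fin (m + 1), (if hh : h.1 + 1 < m + 1 then
      G.trans (τ h).1 (τ h).2.1 (τ h).2.2 (τ ⟨h.1 + 1, hh⟩).1 else 1) =
      ∏ i : Fin m, G.trans (τ i.castSucc).1 (τ i.castSucc).2.1 (τ i.castSucc).2.2 (τ i.succ).1 := by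
    rw [Fin.prod_univ_castSucc, dif_neg (by simp), mul_one]
    refine Finset.prod_congr rfl fun i _ => ?_
    rw [dif_pos (by simp)]
    rfl
  have h2 : ∏ h : Fin (m + 1), μ (G.infoX (τ h).1) (τ h).2.1 * ν (G.infoY (τ h).1) (τ h).2.2 =
      G.stepWeight μ ν (τ 0) * ∏ i : Fin m, G.stepWeight μ ν (τ i.succ) :=
    Fin.prod_univ_succ fun h => G.stepWeight μ ν (τ h)
  rw [trajProb, h1, h2, Finset.prod_mul_distrib]
  ring

lemma playProb_nonneg [NeZero H] (M : G.Rule I) (N : G.Rule J) {T : ℕ} (ω : Fin T → G.Traj) :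
    0 ≤ G.playProb M N ω :=
  Finset.prod_nonneg fun _ _ => G.trajProb_nonneg _ _ _

lemma sum_playProb [NeZero H] (M : G.Rule I) (N : G.Rule J) (T : ℕ) :
    ∑ ω : Fin T → G.Traj, G.playProb M N ω = 1 :=
  sum_seqProb (fun _ _ => G.sum_trajProb _ _) T

lemma prob_mono [NeZero H] (M : G.Rule I) (N : G.Rule J) {T : ℕ}
    {E E' : (Fin T → G.Traj) → Prop} (h : ∀ ω, E ω → E' ω) :
    G.prob M N T E ≤ G.prob M N T E' := by
  refine Finset.sum_le_sum fun ω _ => ?_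
  have := G.playProb_nonneg M N ω
  by_cases h1 : E ω
  · rw [if_pos h1, if_pos (h ω h1)]
  · rw [if_neg h1]; split_ifs <;> simp [this]

lemma prob_eq_one [NeZero H] (M : G.Rule I) (N : G.Rule J) {T : ℕ}
    {E : (Fin T → G.Traj) → Prop} (h : ∀ ω, E ω) : G.prob M N T E = 1 := by
  simp only [prob, h, if_true, sum_playProb]

lemma prob_not [NeZero H] (M : G.Rule I) (N : G.Rule J) {T : ℕ}
    (E : (Fin T → G.Traj) → Prop) : G.prob M N T (fun ω => ¬ E ω) = 1 - G.prob M N T E := by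
  rw [eq_sub_iff_add_eq, ← G.sum_playProb M N T, prob, prob, ← Finset.sum_add_distrib]
  refine Finset.sum_congr rfl fun ω _ => ?_
  by_cases h : E ω <;> simp [h]

lemma value_le [NeZero H] (μ : I.Policy) (ν : J.Policy) : G.value μ ν ≤ H := by
  calc G.value μ ν ≤ ∑ τ, G.trajProb μ ν τ * H := by
        refine Finset.sum_le_sum fun τ _ =>
          mul_le_mul_of_nonneg_left ?_ (G.trajProb_nonneg μ ν τ)
        calc ∑ h, G.stepReward (τ h) ≤ ∑ _h : Fin H, (1 : ℝ) :=
              Finset.sum_le_sum fun h _ => (G.reward_mem _ _ _).2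
          _ = H := by simp
    _ = H := by rw [← Finset.sum_mul, G.sum_trajProb, one_mul]

lemma le_regretMax [NeZero H] (M : G.Rule I) (N : G.Rule J) {T : ℕ} (ω : Fin T → G.Traj)
    (μ' : I.Policy) :
    ∑ t : Fin T, (G.value μ' (N t.1 (G.past ω t)) -
      G.value (M t.1 (G.past ω t)) (N t.1 (G.past ω t))) ≤ G.regretMax M N ω := by
  refine le_ciSup (f := fun μ' : I.Policy => ∑ t : Fin T, (G.value μ' (N t.1 (G.past ω t)) -
      G.value (M t.1 (G.past ω t)) (N t.1 (G.past ω t)))) ?_ μ'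
  -- The supremum is meaningful only for a bounded family; every value is at most `H`.
  refine ⟨∑ t : Fin T, ((H : ℝ) - G.value (M t.1 (G.past ω t)) (N t.1 (G.past ω t))), ?_⟩
  rintro _ ⟨μ, rfl⟩
  exact Finset.sum_le_sum fun t _ => sub_le_sub_right (G.value_le _ _) _

/-! ### The least number of actions and information sets -/

lemma exists_state_depth_zero : ∃ s, I.depth (G.infoX s) = 0 := by
  have h : ∃ s, G.init s ≠ 0 := by
    by_contra! h
    have h1 : ∑ s, G.init s = 1 := G.init.2.2
    simp [h] at h1
  exact h.imp fun s hs => G.init_support s hs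

lemma exists_succ_state (s : G.State) (a : I.Act (G.infoX s)) (b : J.Act (G.infoY s))
    (hs : I.depth (G.infoX s) + 1 < H) : ∃ s',
      I.parent (G.infoX s') = some ⟨G.infoX s, a⟩ ∧
        J.parent (G.infoY s') = some ⟨G.infoY s, b⟩ := by
  have h : ∃ s', G.trans s a b s' ≠ 0 := by
    by_contra! h
    have h1 : ∑ s', G.trans s a b s' = 1 := (G.trans s a b).2.2
    simp [h] at h1
  exact h.imp fun s' hs' => G.trans_support s a b s' hs hs'

/-- Each information set contains a state, and a transition kernel has mass one, so some successor
has positive probability. -/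
lemma exists_child_left (G : Game I J) (x : I.Node) (a : I.Act x) (hx : I.depth x + 1 < H) :
    ∃ x', I.parent x' = some ⟨x, a⟩ := by
  obtain ⟨s, rfl⟩ := G.infoX_surjective x
  obtain ⟨b⟩ := J.actNonempty (G.infoY s)
  exact ⟨_, (G.exists_succ_state s a b hx).choose_spec.1⟩

lemma exists_child_right (G : Game I J) (y : J.Node) (b : J.Act y) (hy : J.depth y + 1 < H) :
    ∃ y', J.parent y' = some ⟨y, b⟩ := by
  obtain ⟨s, rfl⟩ := G.infoY_surjective y
  obtain ⟨a⟩ := I.actNonempty (G.infoX s)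
  rw [← G.depth_eq] at hy
  exact ⟨_, (G.exists_succ_state s a b hy).choose_spec.2⟩

end Game

namespace InfoTree

variable {H : ℕ} (I : InfoTree H)

/-- If every action before the last step leads somewhere, then a tree with at least `A` actions
at every information set has at least `A ^ h` information sets at step `h`. -/
lemma pow_le_card_depth {A : ℕ} (hA : ∀ x, A ≤ Fintype.card (I.Act x))
    (h0 : ∃ x, I.depth x = 0)
    (hc : ∀ x (a : I.Act x), I.depth x + 1 < H → ∃ x', I.parent x' = some ⟨x, a⟩) (h : ℕ)
    (hh : h < H) : A ^ h ≤ (Finset.univ.filter fun x => I.depth x = h).card := by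
  classical
  induction h with
  | zero =>
    rw [pow_zero, Nat.one_le_iff_ne_zero, ← Nat.pos_iff_ne_zero, Finset.card_pos]
    exact h0.imp fun x hx => by simpa using hx
  | succ h ih =>
    choose! child hchild using hc
    calc A ^ (h + 1) ≤ (Finset.univ.filter fun x => I.depth x = h).card * A := by
          rw [pow_succ]; exact Nat.mul_le_mul_right _ (ih (by omega))
      _ ≤ ∑ x with I.depth x = h, Fintype.card (I.Act x) := by
          rw [← smul_eq_mul, ← Finset.sum_const]
          exact Finset.sum_le_sum fun x _ => hA x
      _ = ((Finset.univ.filter fun x => I.depth x = h).sigma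
            fun x => (Finset.univ : Finset (I.Act x))).card := by
          rw [Finset.card_sigma]; rfl
      _ ≤ _ := by
          -- Perfect recall makes this injective: a child determines the pair it comes from.
          refine Finset.card_le_card_of_injOn (fun p => child p.1 p.2) ?_ ?_
          · rintro ⟨x, a⟩ hp
            simp only [Finset.coe_sigma, Finset.coe_filter, Finset.mem_univ, true_and,
              Finset.coe_univ, Set.mem_sigma_iff, Set.mem_ofPred_eq, Set.mem_univ, and_true] at hp
            have := I.depth_child _ _ (hchild x a (by omega))
            simp [this, hp]
          · rintro ⟨x, a⟩ hp ⟨x', a'⟩ hp' heq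
            simp only [Finset.coe_sigma, Finset.coe_filter, Finset.mem_univ, true_and,
              Finset.coe_univ, Set.mem_sigma_iff, Set.mem_ofPred_eq, Set.mem_univ, and_true]
              at hp hp'
            have e1 := hchild x a (by omega)
            have e2 := hchild x' a' (by omega)
            simp only at heq
            rw [heq, e2] at e1
            exact (Option.some.inj e1).symm

lemma treeSize_le_numInfoSets {A : ℕ} (hA : ∀ x, A ≤ Fintype.card (I.Act x))
    (h0 : ∃ x, I.depth x = 0)
    (hc : ∀ x (a : I.Act x), I.depth x + 1 < H → ∃ x', I.parent x' = some ⟨x, a⟩) :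
    treeSize A H ≤ I.numInfoSets := by
  classical
  calc treeSize A H ≤ ∑ h ∈ Finset.range H, (Finset.univ.filter fun x => I.depth x = h).card :=
        Finset.sum_le_sum fun h hh => I.pow_le_card_depth hA h0 hc h (Finset.mem_range.1 hh)
    _ = I.numInfoSets := by
        rw [numInfoSets, ← Finset.card_univ]
        exact (Finset.card_eq_sum_card_fiberwise fun x _ => by simpa using I.depth_lt x).symm

lemma numInfoSets_le_numActions : I.numInfoSets ≤ I.numActions := by
  rw [numInfoSets, numActions, ← Finset.card_univ, Finset.card_eq_sum_ones]
  exact Finset.sum_le_sum fun x _ => Fintype.card_pos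

end InfoTree

namespace Game

variable {H : ℕ} {I J : InfoTree H}

lemma treeSize_le_left (G : Game I J) {A : ℕ} (hA : ∀ x, A ≤ Fintype.card (I.Act x)) :
    treeSize A H ≤ I.numInfoSets :=
  I.treeSize_le_numInfoSets hA (G.exists_state_depth_zero.elim fun _ hs => ⟨_, hs⟩)
    fun x a => G.exists_child_left x a

lemma treeSize_le_right (G : Game I J) {A : ℕ} (hA : ∀ y, A ≤ Fintype.card (J.Act y)) :
    treeSize A H ≤ J.numInfoSets :=
  J.treeSize_le_numInfoSets hA
    (G.exists_state_depth_zero.elim fun s hs => ⟨_, (G.depth_eq s).symm.trans hs⟩)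
    fun y b => G.exists_child_right y b

end Game

lemma treeSize_one (H : ℕ) : treeSize 1 H = H := by simp [treeSize]

/-- Every game of length `H` has at least `H` actions for each player. -/
lemma le_numActions {H : ℕ} {I J : InfoTree H} (G : Game I J) :
    H ≤ I.numActions ∧ H ≤ J.numActions := by
  -- Action sets are non-empty, so the bound on information sets applies with one action each.
  have h1 := (G.treeSize_le_left (A := 1) fun x => Fintype.card_pos).trans
    I.numInfoSets_le_numActions
  have h2 := (G.treeSize_le_right (A := 1) fun x => Fintype.card_pos).trans
    J.numInfoSets_le_numActions
  rw [treeSize_one] at h1 h2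
  exact ⟨h1, h2⟩

/-! ### Games with a hidden bit on a pair of deterministic trees -/

/-- A choice of an initial information set and of a successor for every action. -/
structure InfoTree.Succession {H : ℕ} (I : InfoTree H) where
  root : I.Node
  parent_root : I.parent root = none
  child : (x : I.Node) → I.Act x → I.Node
  parent_child : ∀ x a, I.depth x + 1 < H → I.parent (child x a) = some ⟨x, a⟩

namespace InfoTree.Succession

variable {H : ℕ} {I : InfoTree H} (D : I.Succession)

lemma depth_root : I.depth D.root = 0 := I.depth_root _ D.parent_root

lemma depth_child (x : I.Node) (a : I.Act x) (hx : I.depth x + 1 < H) :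
    I.depth (D.child x a) = I.depth x + 1 :=
  I.depth_child _ _ (D.parent_child x a hx)

lemma exists_depth (D : I.Succession) (h : ℕ) (hh : h < H) : ∃ x, I.depth x = h := by
  induction h with
  | zero => exact ⟨_, D.depth_root⟩
  | succ h ih =>
    obtain ⟨x, hx⟩ := ih (by omega)
    obtain ⟨a⟩ := I.actNonempty x
    exact ⟨D.child x a, by rw [D.depth_child x a (by omega), hx]⟩

end InfoTree.Succession

/-- A pair of information sets of the same step together with a hidden bit. -/
abbrev BitState {H : ℕ} (I J : InfoTree H) : Type :=
  {p : I.Node × J.Node // I.depth p.1 = J.depth p.2} × Bool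

/-- The data of a family of games in which the actions of the players determine an arm, and the
reward of every step from `start` on is a Bernoulli variable that depends on the arm. -/
structure BitSetup {H : ℕ} (I J : InfoTree H) (ι : Type) where
  left : I.Succession
  right : J.Succession
  arm : (Σ x, I.Act x) → (Σ y, J.Act y) → ι
  start : ℕ
  start_lt : start < H
  -- Once rewards begin the arm is settled, so all rewards of an episode carry the same information.
  arm_child : ∀ x a y b a' b', I.depth x = J.depth y → start ≤ I.depth x → I.depth x + 1 < H →
    arm ⟨left.child x a, a'⟩ ⟨right.child y b, b'⟩ = arm ⟨x, a⟩ ⟨y, b⟩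
  /-- the arm with the constant reward `1 / 2` -/
  base : ι
  /-- whether the arms are good or bad for the max-player -/
  sign : ℝ
  sign_mem : |sign| ≤ 1
  gap : ℝ
  gap_pos : 0 < gap
  gap_le : gap ≤ 3 / 8

namespace BitSetup

variable {H : ℕ} {I J : InfoTree H} {ι : Type} (S : BitSetup I J ι)

/-- The distribution of the hidden bit. -/
def weight (u : Bool) : ℝ := if u then 1 / 2 - S.gap else 1 / 2 + S.gap

lemma weight_pos (u : Bool) : 0 < S.weight u := by
  have h1 := S.gap_pos
  have h2 := S.gap_le
  unfold weight; split_ifs <;> linarith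

/-- The deterministic motion of the information sets, which preserves the hidden bit. -/
def next (s : BitState I J) (a : I.Act s.1.1.1) (b : J.Act s.1.1.2) : BitState I J :=
  if h : I.depth s.1.1.1 + 1 < H then
    (⟨(S.left.child _ a, S.right.child _ b), by
      rw [S.left.depth_child _ a h, S.right.depth_child _ b (by rw [← s.1.2]; exact h), s.1.2]⟩,
      s.2)
  else s

/-- The initial pair of information sets. -/
def roots : {p : I.Node × J.Node // I.depth p.1 = J.depth p.2} :=
  ⟨(S.left.root, S.right.root), by rw [S.left.depth_root, S.right.depth_root]⟩

/-- The centred value of the hidden bit. -/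
def bitValue (u : Bool) : ℝ := if u then 1 / 2 else -1 / 2

open Classical in
/-- How the reward of the arm `j` depends on the hidden bit when the arm `e`, if any, is the
special one. -/
def effect (e : Option ι) (j : ι) : ℝ := if j = S.base then 0 else if e = some j then -1 else 1

/-- The reward of an arm. -/
def payoff (e : Option ι) (j : ι) (u : Bool) : ℝ :=
  1 / 2 + S.sign * (S.effect e j * bitValue u)

lemma payoff_mem (e : Option ι) (j : ι) (u : Bool) : S.payoff e j u ∈ Set.Icc (0 : ℝ) 1 := by
  have h1 : |S.effect e j| ≤ 1 := by unfold effect; split_ifs <;> simp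
  have h2 : |bitValue u| = 1 / 2 := by cases u <;> norm_num [bitValue, abs_of_pos, abs_of_neg]
  have h3 : |S.sign * (S.effect e j * bitValue u)| ≤ 1 / 2 := by
    rw [abs_mul, abs_mul, h2]
    nlinarith [S.sign_mem, abs_nonneg S.sign, abs_nonneg (S.effect e j),
      mul_le_one₀ S.sign_mem (abs_nonneg _) h1]
  rw [abs_le] at h3
  constructor <;> unfold payoff <;> linarith [h3.1, h3.2]

open Classical in
/-- The game in which the arm `e`, if any, is the special one. -/
@[reducible] def game (e : Option ι) : Game I J where
  State := BitState I J
  infoX s := s.1.1.1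
  infoY s := s.1.1.2
  infoX_surjective x := by
    obtain ⟨y, hy⟩ := S.right.exists_depth (I.depth x) (I.depth_lt x)
    exact ⟨(⟨(x, y), hy.symm⟩, true), rfl⟩
  infoY_surjective y := by
    obtain ⟨x, hx⟩ := S.left.exists_depth (J.depth y) (J.depth_lt y)
    exact ⟨(⟨(x, y), hx⟩, true), rfl⟩
  depth_eq s := s.1.2
  init := ⟨fun s => if s.1 = S.roots then S.weight s.2 else 0, fun s => by
    dsimp only; split_ifs
    · exact (S.weight_pos _).le
    · exact le_rfl, by
    rw [Fintype.sum_prod_type]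
    simp [weight, Finset.sum_add_distrib]
    ring⟩
  init_support s hs := by
    have : s.1 = S.roots := by
      by_contra h
      exact hs (if_neg h)
    rw [this]
    exact S.left.depth_root
  trans s a b := ⟨Pi.single (S.next s a b) 1, single_mem_stdSimplex ℝ _⟩
  trans_support s a b s' hs hs' := by
    have : s' = S.next s a b := by
      by_contra h
      exact hs' (Pi.single_eq_of_ne h _)
    subst this
    rw [next, dif_pos hs]
    exact ⟨S.left.parent_child _ a hs, S.right.parent_child _ b (by rw [← s.1.2]; exact hs)⟩
  reward s a b := if I.depth s.1.1.1 < S.start then 0 else S.payoff e (S.arm ⟨_, a⟩ ⟨_, b⟩) s.2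
  reward_mem s a b := by
    split_ifs
    · exact ⟨le_rfl, zero_le_one⟩
    · exact S.payoff_mem _ _ _

/-- The episodes of the games of the family. -/
abbrev Episode (_ : BitSetup I J ι) : Type :=
  Fin H → Σ s : BitState I J, I.Act s.1.1.1 × J.Act s.1.1.2

/-- The arm that a step points to. -/
def stepArm (z : Σ s : BitState I J, I.Act s.1.1.1 × J.Act s.1.1.2) : ι :=
  S.arm ⟨_, z.2.1⟩ ⟨_, z.2.2⟩

/-- Flips the hidden bit. -/
def flip (τ : S.Episode) : S.Episode := fun h => ⟨((τ h).1.1, !(τ h).1.2), (τ h).2⟩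

lemma flip_flip (τ : S.Episode) : S.flip (S.flip τ) = τ := by
  have key : ∀ z : Σ s : BitState I J, I.Act s.1.1.1 × J.Act s.1.1.2,
      (⟨(z.1.1, !!z.1.2), z.2⟩ : Σ s : BitState I J, I.Act s.1.1.1 × J.Act s.1.1.2) = z := by
    rintro ⟨⟨p, _ | _⟩, q⟩ <;> rfl
  exact funext fun h => key (τ h)

lemma next_flip (s : BitState I J) (a : I.Act s.1.1.1) (b : J.Act s.1.1.2) :
    S.next (s.1, !s.2) a b = ((S.next s a b).1, !(S.next s a b).2) := by
  unfold next
  by_cases h : I.depth s.1.1.1 + 1 < H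
  · rw [dif_pos h, dif_pos h]
  · rw [dif_neg h, dif_neg h]

/-- The left side is the divergence between the bit and its flip. Since `gap ≤ 3 / 8`, the smaller
weight is at least `1 / 8`, and `log x ≤ x - 1` gives the factor `16`. -/
lemma information_le : 2 * S.gap * Real.log (S.weight false / S.weight true) ≤ 32 * S.gap ^ 2 := by
  have h1 := S.gap_pos
  have h2 := S.gap_le
  have h3 : Real.log (S.weight false / S.weight true) ≤ 16 * S.gap := by
    refine (Real.log_le_sub_one_of_pos (div_pos (S.weight_pos _) (S.weight_pos _))).trans ?_
    rw [sub_le_iff_le_add, div_le_iff₀ (S.weight_pos _)]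
    simp only [weight, if_true]
    norm_num
    nlinarith
  nlinarith

variable [NeZero H]

/-- The last step. -/
def lastStep (H : ℕ) [NeZero H] : Fin H := ⟨H - 1, Nat.sub_one_lt (NeZero.ne H)⟩

/-- The probability of an episode, which is the same in all games of the family. -/
def law (μ : I.Policy) (ν : J.Policy) (τ : S.Episode) : ℝ := (S.game none).trajProb μ ν τ

/-- The special arm enters only the reward function, so it can affect the play only through what the
algorithm observes. -/
lemma trajProb_game (e : Option ι) (μ : I.Policy) (ν : J.Policy) (τ : S.Episode) :
    (S.game e).trajProb μ ν τ = S.law μ ν τ := rfl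

lemma law_nonneg (μ : I.Policy) (ν : J.Policy) (τ : S.Episode) : 0 ≤ S.law μ ν τ :=
  Game.trajProb_nonneg _ _ _ _

lemma sum_law (μ : I.Policy) (ν : J.Policy) : ∑ τ : S.Episode, S.law μ ν τ = 1 :=
  (S.game none).sum_trajProb μ ν

/-- The episodes that respect the deterministic motion. -/
def Valid (τ : S.Episode) : Prop :=
  (τ 0).1.1 = S.roots ∧
    ∀ (h : Fin H) (hh : h.1 + 1 < H), (τ ⟨h.1 + 1, hh⟩).1 = S.next (τ h).1 (τ h).2.1 (τ h).2.2

open Classical in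
lemma valid_of_law_ne_zero {μ : I.Policy} {ν : J.Policy} {τ : S.Episode}
    (h : S.law μ ν τ ≠ 0) : S.Valid τ := by
  rw [law, Game.trajProb, mul_ne_zero_iff, mul_ne_zero_iff, Finset.prod_ne_zero_iff,
    Finset.prod_ne_zero_iff] at h
  obtain ⟨⟨h1, -⟩, h3⟩ := h
  refine ⟨?_, fun i hi => ?_⟩
  · by_contra hc
    exact h1 (if_neg hc)
  · have := h3 i (Finset.mem_univ _)
    rw [dif_pos hi] at this
    by_contra hc
    exact this (Pi.single_eq_of_ne hc _)

/-- In an episode of positive probability only actions of positive probability occur. -/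
lemma policy_ne_zero_of_law_ne_zero {μ : I.Policy} {ν : J.Policy} {τ : S.Episode}
    (h : S.law μ ν τ ≠ 0) (i : Fin H) :
    μ _ (τ i).2.1 ≠ 0 ∧ ν _ (τ i).2.2 ≠ 0 := by
  rw [law, Game.trajProb, mul_ne_zero_iff, mul_ne_zero_iff, Finset.prod_ne_zero_iff,
    Finset.prod_ne_zero_iff] at h
  exact mul_ne_zero_iff.1 (h.1.2 i (Finset.mem_univ _))

/-- The arm of an episode. -/
def armOf (τ : S.Episode) : ι := S.stepArm (τ (lastStep H))

/-- The hidden bit of an episode. -/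
def bitOf (τ : S.Episode) : Bool := (τ 0).1.2

lemma Valid.depth_and_bit {S : BitSetup I J ι} {τ : S.Episode} (hτ : S.Valid τ) (h : ℕ)
    (hh : h < H) : I.depth (τ ⟨h, hh⟩).1.1.1.1 = h ∧ (τ ⟨h, hh⟩).1.2 = S.bitOf τ := by
  induction h with
  | zero =>
    have h0 : (⟨0, hh⟩ : Fin H) = 0 := rfl
    rw [h0, hτ.1]
    exact ⟨S.left.depth_root, rfl⟩
  | succ h ih =>
    obtain ⟨h1, h2⟩ := ih (by omega)
    rw [hτ.2 ⟨h, by omega⟩ hh, next, dif_pos (by rw [h1]; exact hh)]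
    refine ⟨?_, h2⟩
    rw [S.left.depth_child _ _ (by rw [h1]; exact hh), h1]

lemma Valid.stepArm_succ {S : BitSetup I J ι} {τ : S.Episode} (hτ : S.Valid τ)
    (h : ℕ) (hh : h + 1 < H) (hs : S.start ≤ h) :
    S.stepArm (τ ⟨h + 1, hh⟩) = S.stepArm (τ ⟨h, by omega⟩) := by
  have h1 := (hτ.depth_and_bit h (by omega)).1
  have h2 := hτ.2 ⟨h, by omega⟩ hh
  rw [next, dif_pos (by rw [h1]; exact hh)] at h2
  -- The successor state is made a variable, so that the actions, whose types depend on it, survive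
  -- the substitution.
  have key : ∀ (s s' : BitState I J) (p : I.Act s.1.1.1 × J.Act s.1.1.2)
      (q : I.Act s'.1.1.1 × J.Act s'.1.1.2) (hd : I.depth s.1.1.1 = h),
      s' = (⟨(S.left.child _ p.1, S.right.child _ p.2), by
        rw [S.left.depth_child _ _ (by omega), S.right.depth_child _ _ (by rw [← s.1.2]; omega),
          s.1.2]⟩, s.2) → S.stepArm ⟨s', q⟩ = S.stepArm ⟨s, p⟩ := by
    rintro s s' p q hd rfl
    exact S.arm_child _ _ _ _ _ _ s.1.2 (by omega) (by omega)
  exact key _ _ _ _ h1 h2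

lemma Valid.stepArm_eq_armOf {S : BitSetup I J ι} {τ : S.Episode} (hτ : S.Valid τ)
    (h : ℕ) (hh : h < H) (hs : S.start ≤ h) :
    S.stepArm (τ ⟨h, hh⟩) = S.armOf τ := by
  have key : ∀ k (hk : h + k < H), S.stepArm (τ ⟨h + k, hk⟩) = S.stepArm (τ ⟨h, hh⟩) := by
    intro k
    induction k with
    | zero => intro _; rfl
    | succ k ih =>
      intro hk
      exact (hτ.stepArm_succ (h + k) hk (by omega)).trans (ih (by omega))
  rw [armOf, ← key (H - 1 - h) (by omega)]
  congr 3
  omega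

/-- The rewards of an episode are those of its arm. -/
lemma Valid.stepReward_eq {S : BitSetup I J ι} {τ : S.Episode} (hτ : S.Valid τ)
    (e : Option ι) (h : Fin H) :
    (S.game e).stepReward (τ h) =
      if h.1 < S.start then 0 else S.payoff e (S.armOf τ) (S.bitOf τ) := by
  obtain ⟨h1, h2⟩ := hτ.depth_and_bit h.1 h.2
  have : (S.game e).stepReward (τ h) = if I.depth (τ h).1.1.1.1 < S.start then 0 else
    S.payoff e (S.stepArm (τ h)) (τ h).1.2 := rfl
  rw [this, h1, h2]
  by_cases hs : h.1 < S.start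
  · rw [if_pos hs, if_pos hs]
  · rw [if_neg hs, if_neg hs, ← hτ.stepArm_eq_armOf h.1 h.2 (by omega)]

/-! ### Changing the special arm -/

lemma armOf_flip (τ : S.Episode) : S.armOf (S.flip τ) = S.armOf τ := rfl

lemma bitOf_flip (τ : S.Episode) : S.bitOf (S.flip τ) = !S.bitOf τ := rfl

/-- `flip` as a permutation. -/
def flipEquiv : S.Episode ≃ S.Episode := ⟨S.flip, S.flip, S.flip_flip, S.flip_flip⟩

lemma valid_flip {τ : S.Episode} (hτ : S.Valid τ) : S.Valid (S.flip τ) := by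
  refine ⟨hτ.1, fun h hh => ?_⟩
  have : (S.flip τ ⟨h.1 + 1, hh⟩).1 = ((τ ⟨h.1 + 1, hh⟩).1.1, !(τ ⟨h.1 + 1, hh⟩).1.2) := rfl
  rw [this, hτ.2 h hh]
  exact (S.next_flip _ _ _).symm

/-- The motion ignores the bit and the policies do not see it, so only the initial distribution
changes. The ratio of weights is written cross-multiplied. -/
lemma law_flip (μ : I.Policy) (ν : J.Policy) (τ : S.Episode) :
    S.law μ ν (S.flip τ) * S.weight (S.bitOf τ) = S.law μ ν τ * S.weight (!S.bitOf τ) := by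
  classical
  have h1 : (S.game none).init (S.flip τ 0).1 * S.weight (S.bitOf τ) =
      (S.game none).init (τ 0).1 * S.weight (!S.bitOf τ) := by
    change (if (τ 0).1.1 = S.roots then S.weight (!(τ 0).1.2) else 0) * S.weight (τ 0).1.2 =
      (if (τ 0).1.1 = S.roots then S.weight (τ 0).1.2 else 0) * S.weight (!(τ 0).1.2)
    split_ifs <;> ring
  have h2 : ∀ h h' : Fin H, (S.game none).trans (S.flip τ h).1 (S.flip τ h).2.1 (S.flip τ h).2.2
      (S.flip τ h').1 = (S.game none).trans (τ h).1 (τ h).2.1 (τ h).2.2 (τ h').1 := by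
    intro h h'
    change (Pi.single (S.next ((τ h).1.1, !(τ h).1.2) (τ h).2.1 (τ h).2.2) 1 :
        BitState I J → ℝ) ((τ h').1.1, !(τ h').1.2) =
      (Pi.single (S.next (τ h).1 (τ h).2.1 (τ h).2.2) 1 : BitState I J → ℝ) (τ h').1
    rw [S.next_flip, Pi.single_apply, Pi.single_apply]
    refine if_congr ?_ rfl rfl
    rw [Prod.ext_iff, Prod.ext_iff]
    simp
  have h3 : S.law μ ν (S.flip τ) = (S.game none).init (S.flip τ 0).1 *
      (∏ h : Fin H, μ _ (τ h).2.1 * ν _ (τ h).2.2) *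
      ∏ h : Fin H, if hh : h.1 + 1 < H then
        (S.game none).trans (τ h).1 (τ h).2.1 (τ h).2.2 (τ ⟨h.1 + 1, hh⟩).1 else 1 := by
    rw [law, Game.trajProb]
    congr 1
    refine Finset.prod_congr rfl fun h _ => ?_
    by_cases hh : h.1 + 1 < H
    · rw [dif_pos hh, dif_pos hh, h2]
    · rw [dif_neg hh, dif_neg hh]
  rw [h3, law, Game.trajProb]
  linear_combination ((∏ h : Fin H, μ _ (τ h).2.1 * ν _ (τ h).2.2) *
      ∏ h : Fin H, if hh : h.1 + 1 < H then
        (S.game none).trans (τ h).1 (τ h).2.1 (τ h).2.2 (τ ⟨h.1 + 1, hh⟩).1 else 1) * h1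

open Classical in
/-- Flips the hidden bit in the episodes with arm `i`. -/
def switch (i : ι) (τ : S.Episode) : S.Episode := if S.armOf τ = i then S.flip τ else τ

lemma switch_switch (i : ι) (τ : S.Episode) : S.switch i (S.switch i τ) = τ := by
  unfold switch
  by_cases h : S.armOf τ = i
  · rw [if_pos h, if_pos (by rwa [armOf_flip]), flip_flip]
  · rw [if_neg h, if_neg h]

/-- `switch` as a permutation. -/
def switchEquiv (i : ι) : S.Episode ≃ S.Episode :=
  ⟨S.switch i, S.switch i, S.switch_switch i, S.switch_switch i⟩

lemma armOf_switch (i : ι) (τ : S.Episode) : S.armOf (S.switch i τ) = S.armOf τ := by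
  unfold switch; split_ifs <;> simp [armOf_flip]

lemma valid_switch (i : ι) {τ : S.Episode} (hτ : S.Valid τ) : S.Valid (S.switch i τ) := by
  unfold switch; split_ifs
  · exact S.valid_flip hτ
  · exact hτ

open Classical in
/-- The log-likelihood ratio of an episode when `i` becomes the special arm. -/
def logRatio (i : ι) (τ : S.Episode) : ℝ :=
  (if S.armOf τ = i then 1 else 0) *
    Real.log (S.weight (S.bitOf τ) / S.weight (!S.bitOf τ))

/-- The change of measure behind the argument: the ratio differs from one only on the episodes with
arm `i`. -/
lemma law_switch (i : ι) (μ : I.Policy) (ν : J.Policy) (τ : S.Episode) :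
    S.law μ ν (S.switch i τ) = S.law μ ν τ * Real.exp (-S.logRatio i τ) := by
  unfold switch logRatio
  by_cases h : S.armOf τ = i
  · have h1 := S.weight_pos (S.bitOf τ)
    have h2 := S.weight_pos (!S.bitOf τ)
    rw [if_pos h, if_pos h, one_mul, Real.exp_neg, Real.exp_log (div_pos h1 h2), inv_div,
      ← mul_div_assoc, eq_div_iff h1.ne', law_flip]
  · simp [h]

/-- On arm `i` the opposite sign of the special arm cancels the flip of the bit; other arms are not
switched. The base arm ignores the bit, so `i = S.base` is no exception. -/
lemma payoff_switch {i : ι} (τ : S.Episode) :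
    S.payoff (some i) (S.armOf τ) (S.bitOf (S.switch i τ)) =
      S.payoff none (S.armOf τ) (S.bitOf τ) := by
  by_cases h : S.armOf τ = i
  · subst h
    have h' : S.switch (S.armOf τ) τ = S.flip τ := if_pos rfl
    rw [h', bitOf_flip, payoff, payoff, effect, effect]
    cases S.bitOf τ <;> simp [bitValue] <;> split_ifs <;> norm_num
  · have h' : S.switch i τ = τ := if_neg h
    rw [h', payoff, payoff, effect, effect]
    simp [Ne.symm h]

lemma stepReward_switch (i : ι) {τ : S.Episode} (hτ : S.Valid τ) (h : Fin H) :
    (S.game (some i)).stepReward (S.switch i τ h) = (S.game none).stepReward (τ h) := by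
  rw [(S.valid_switch i hτ).stepReward_eq, hτ.stepReward_eq, armOf_switch, payoff_switch]

lemma switch_actions (i : ι) (τ : S.Episode) (h : Fin H) :
    (⟨(S.switch i τ h).1.1.1.1, (S.switch i τ h).2.1⟩ : Σ x, I.Act x) =
        ⟨(τ h).1.1.1.1, (τ h).2.1⟩ ∧
      (⟨(S.switch i τ h).1.1.1.2, (S.switch i τ h).2.2⟩ : Σ y, J.Act y) =
        ⟨(τ h).1.1.1.2, (τ h).2.2⟩ := by
  have h' : S.switch i τ = S.flip τ ∨ S.switch i τ = τ := by
    unfold switch; split_ifs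
    · exact Or.inl rfl
    · exact Or.inr rfl
  rcases h' with h' | h' <;> rw [h'] <;> exact ⟨rfl, rfl⟩

/-- The bit is visible only through the rewards, and these are preserved. -/
lemma obsMax_switch (i : ι) {τ : S.Episode} (hτ : S.Valid τ) :
    (S.game (some i)).obsMax (S.switch i τ) = (S.game none).obsMax τ := by
  funext h
  exact Prod.ext (S.switch_actions i τ h).1 (S.stepReward_switch i hτ h)

lemma obsBoth_switch (i : ι) {τ : S.Episode} (hτ : S.Valid τ) :
    (S.game (some i)).obsBoth (S.switch i τ) = (S.game none).obsBoth τ := by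
  funext h
  exact Prod.ext (S.switch_actions i τ h).1
    (Prod.ext (S.switch_actions i τ h).2 (S.stepReward_switch i hτ h))

/-! ### Values -/

/-- The hidden bit is independent of the arm. -/
lemma sum_law_mul (μ : I.Policy) (ν : J.Policy) (φ : ι → ℝ) (f : Bool → ℝ) :
    ∑ τ : S.Episode, S.law μ ν τ * (φ (S.armOf τ) * f (S.bitOf τ)) =
      (∑ τ : S.Episode, S.law μ ν τ * φ (S.armOf τ)) *
        (S.weight true * f true + S.weight false * f false) := by
  set m : Bool → ℝ := fun u => ∑ τ : S.Episode,
    S.law μ ν τ * φ (S.armOf τ) * (if S.bitOf τ = u then 1 else 0) with hm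
  have hsplit : ∀ g : Bool → ℝ, ∑ τ : S.Episode, S.law μ ν τ * (φ (S.armOf τ) * g (S.bitOf τ)) =
      m true * g true + m false * g false := fun g => by
    simp only [hm, Finset.sum_mul]
    rw [← Finset.sum_add_distrib]
    refine Finset.sum_congr rfl fun τ _ => ?_
    cases S.bitOf τ <;> simp <;> ring
  -- Flipping the bit exchanges the two masses and keeps the arm; by `law_flip` they stand in the
  -- ratio of the weights.
  have hbal : m true * S.weight false = m false * S.weight true := by
    simp only [hm, Finset.sum_mul]
    rw [← S.flipEquiv.sum_comp]
    refine Finset.sum_congr rfl fun τ _ => ?_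
    have h1 := S.law_flip μ ν τ
    have h2 : S.flipEquiv τ = S.flip τ := rfl
    rw [h2, armOf_flip, bitOf_flip]
    cases hb : S.bitOf τ
    · rw [hb] at h1
      simp only [Bool.not_false, if_true, mul_one] at h1 ⊢
      linear_combination φ (S.armOf τ) * h1
    · simp
  have htot : ∑ τ : S.Episode, S.law μ ν τ * φ (S.armOf τ) = m true + m false := by
    simpa using hsplit fun _ => 1
  have hw : S.weight true + S.weight false = 1 := by simp [weight]; ring
  rw [hsplit, htot]
  have e1 : m true = (m true + m false) * S.weight true := by
    linear_combination (-m true) * hw + hbal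
  have e2 : m false = (m true + m false) * S.weight false := by
    linear_combination (-m false) * hw - hbal
  linear_combination f true * e1 + f false * e2

open Classical in
/-- The probability of an arm. -/
def armProb (μ : I.Policy) (ν : J.Policy) (j : ι) : ℝ :=
  ∑ τ : S.Episode, S.law μ ν τ * if S.armOf τ = j then 1 else 0

lemma armProb_nonneg (μ : I.Policy) (ν : J.Policy) (j : ι) : 0 ≤ S.armProb μ ν j :=
  Finset.sum_nonneg fun τ _ => mul_nonneg (S.law_nonneg _ _ _) (by split_ifs <;> simp)

lemma armProb_add_le {i j : ι} (hij : i ≠ j) (μ : I.Policy) (ν : J.Policy) :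
    S.armProb μ ν i + S.armProb μ ν j ≤ 1 := by
  rw [← S.sum_law μ ν, armProb, armProb, ← Finset.sum_add_distrib]
  refine Finset.sum_le_sum fun τ _ => ?_
  have := S.law_nonneg μ ν τ
  by_cases h : S.armOf τ = i
  · have h' : S.armOf τ ≠ j := h ▸ hij
    rw [if_pos h, if_neg h']; linarith
  · rw [if_neg h]; split_ifs <;> linarith

lemma armProb_eq_one {j : ι} {μ : I.Policy} {ν : J.Policy}
    (h : ∀ τ : S.Episode, S.law μ ν τ ≠ 0 → S.armOf τ = j) : S.armProb μ ν j = 1 := by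
  rw [← S.sum_law μ ν, armProb]
  refine Finset.sum_congr rfl fun τ _ => ?_
  by_cases h0 : S.law μ ν τ = 0
  · rw [h0, zero_mul]
  · rw [if_pos (h τ h0), mul_one]

/-- The `H - start` rewarded steps all pay the same amount, and the centred bit has mean `-gap`
independently of the arm. -/
lemma value_game (e : Option ι) (μ : I.Policy) (ν : J.Policy) :
    (S.game e).value μ ν = ((H : ℝ) - S.start) *
      (1 / 2 - S.sign * S.gap * ∑ τ : S.Episode, S.law μ ν τ * S.effect e (S.armOf τ)) := by
  have h1 : (S.game e).value μ ν = ∑ τ : S.Episode, S.law μ ν τ *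
      (((H : ℝ) - S.start) * S.payoff e (S.armOf τ) (S.bitOf τ)) := by
    refine Finset.sum_congr rfl fun τ _ => ?_
    rw [S.trajProb_game]
    by_cases h0 : S.law μ ν τ = 0
    · rw [h0, zero_mul, zero_mul]
    have hτ := S.valid_of_law_ne_zero h0
    simp_rw [hτ.stepReward_eq]
    rw [Fin.sum_univ_eq_sum_range
      (fun h => if h < S.start then (0 : ℝ) else S.payoff e (S.armOf τ) (S.bitOf τ)) H,
      Finset.sum_ite, Finset.sum_const_zero, zero_add, Finset.sum_const]
    have : (Finset.range H).filter (fun h => ¬ h < S.start) = Finset.Ico S.start H := by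
      ext h; simp; omega
    rw [this, Nat.card_Ico, nsmul_eq_mul, Nat.cast_sub S.start_lt.le]
  have h2 := S.sum_law_mul μ ν (S.effect e) bitValue
  have h3 : S.weight true * bitValue true + S.weight false * bitValue false = -S.gap := by
    simp [weight, bitValue]; ring
  rw [h3] at h2
  have h4 : ∑ τ : S.Episode, S.law μ ν τ * (((H : ℝ) - S.start) *
      S.payoff e (S.armOf τ) (S.bitOf τ)) = ((H : ℝ) - S.start) * (1 / 2 *
        (∑ τ : S.Episode, S.law μ ν τ) + S.sign * ∑ τ : S.Episode,
          S.law μ ν τ * (S.effect e (S.armOf τ) * bitValue (S.bitOf τ))) := by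
    rw [Finset.mul_sum, Finset.mul_sum, ← Finset.sum_add_distrib, Finset.mul_sum]
    refine Finset.sum_congr rfl fun τ _ => ?_
    unfold payoff; ring
  rw [h1, h4, h2, sum_law]
  ring

lemma value_game_none (μ : I.Policy) (ν : J.Policy) :
    (S.game none).value μ ν = ((H : ℝ) - S.start) *
      (1 / 2 - S.sign * S.gap * (1 - S.armProb μ ν S.base)) := by
  have h : ∑ τ : S.Episode, S.law μ ν τ * S.effect none (S.armOf τ) =
      1 - S.armProb μ ν S.base := by
    rw [← S.sum_law μ ν, armProb, ← Finset.sum_sub_distrib]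
    refine Finset.sum_congr rfl fun τ _ => ?_
    unfold effect
    by_cases h : S.armOf τ = S.base <;> simp [h]
  rw [value_game, h]

lemma value_game_some {i : ι} (hi : i ≠ S.base) (μ : I.Policy) (ν : J.Policy) :
    (S.game (some i)).value μ ν = ((H : ℝ) - S.start) *
      (1 / 2 - S.sign * S.gap * (1 - S.armProb μ ν S.base - 2 * S.armProb μ ν i)) := by
  have h : ∑ τ : S.Episode, S.law μ ν τ * S.effect (some i) (S.armOf τ) =
      1 - S.armProb μ ν S.base - 2 * S.armProb μ ν i := by
    rw [← S.sum_law μ ν, armProb, armProb, Finset.mul_sum, ← Finset.sum_sub_distrib,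
      ← Finset.sum_sub_distrib]
    refine Finset.sum_congr rfl fun τ _ => ?_
    unfold effect
    by_cases h : S.armOf τ = S.base
    · simp [h, hi.symm]
    · by_cases h' : S.armOf τ = i
      · simp [h', hi]; ring
      · simp [h, h', Ne.symm h']
  rw [value_game, h]

/-- The information that one episode gives about the special arm. -/
lemma sum_law_mul_logRatio (i : ι) (μ : I.Policy) (ν : J.Policy) :
    ∑ τ : S.Episode, S.law μ ν τ * S.logRatio i τ =
      S.armProb μ ν i * (2 * S.gap * Real.log (S.weight false / S.weight true)) := by
  classical
  have := S.sum_law_mul μ ν (fun j => if j = i then 1 else 0)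
    (fun u => Real.log (S.weight u / S.weight (!u)))
  have h1 : Real.log (S.weight true / S.weight false) =
      -Real.log (S.weight false / S.weight true) := by rw [← Real.log_inv, inv_div]
  have h2 : ∑ τ : S.Episode, S.law μ ν τ * S.logRatio i τ = ∑ τ : S.Episode, S.law μ ν τ *
      ((if S.armOf τ = i then 1 else 0) *
        Real.log (S.weight (S.bitOf τ) / S.weight (!S.bitOf τ))) :=
    Finset.sum_congr rfl fun τ _ => by unfold logRatio; congr
  have h3 : S.armProb μ ν i = ∑ τ : S.Episode, S.law μ ν τ * if S.armOf τ = i then 1 else 0 :=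
    Finset.sum_congr rfl fun τ _ => by congr
  rw [h2, this, ← h3, Bool.not_true, Bool.not_false, h1]
  congr 1
  simp only [weight, if_true]
  norm_num
  ring

end BitSetup

/-! ### Comparing the play of an algorithm in two games of the family -/

namespace BitSetup

variable {H : ℕ} {I J : InfoTree H} {ι : Type} (S : BitSetup I J ι) [NeZero H]

/-- The rules `M₀` and `M₁` act in the same way on episodes that agree up to a switch of the hidden
bit for the arm `i`. -/
def Compatible {K : InfoTree H} (i : ι) (M₀ M₁ : (t : ℕ) → (Fin t → S.Episode) → K.Policy) :
    Prop :=
  ∀ t (past : Fin t → S.Episode), (∀ u, S.Valid (past u)) →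
    M₁ t (fun u => S.switch i (past u)) = M₀ t past

lemma playProb_eq_zero {e : Option ι} (M : (S.game e).Rule I) (N : (S.game e).Rule J) {T : ℕ}
    (ω : Fin T → S.Episode) (t : Fin T) (ht : ¬ S.Valid (ω t)) : (S.game e).playProb M N ω = 0 :=
  Finset.prod_eq_zero (Finset.mem_univ t)
    (by_contra fun h => ht (S.valid_of_law_ne_zero (τ := ω t) h))

/-- Compatible rules choose the same policies on switched histories, so the likelihood ratios of the
single episodes multiply. -/
lemma playProb_switch {i : ι} {M₀ : (S.game none).Rule I} {M₁ : (S.game (some i)).Rule I}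
    {N₀ : (S.game none).Rule J} {N₁ : (S.game (some i)).Rule J} (hM : S.Compatible i M₀ M₁)
    (hN : S.Compatible i N₀ N₁) {T : ℕ} (ω : Fin T → S.Episode) :
    (S.game (some i)).playProb M₁ N₁ (fun t => S.switch i (ω t)) =
      (S.game none).playProb M₀ N₀ ω * Real.exp (-∑ t, S.logRatio i (ω t)) := by
  by_cases hω : ∀ t, S.Valid (ω t)
  · rw [← Finset.sum_neg_distrib, Real.exp_sum, Game.playProb, Game.playProb,
      ← Finset.prod_mul_distrib]
    refine Finset.prod_congr rfl fun t _ => ?_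
    have h1 := hM t.1 ((S.game none).past ω t) fun u => hω _
    have h2 := hN t.1 ((S.game none).past ω t) fun u => hω _
    have h3 : (S.game (some i)).past (fun t => S.switch i (ω t)) t =
      fun u => S.switch i ((S.game none).past ω t u) := rfl
    rw [h3, h1, h2]
    exact S.law_switch i _ _ _
  -- `switch` is an involution that preserves validity, so an invalid episode makes both sides zero.
  · push Not at hω
    obtain ⟨t, ht⟩ := hω
    have ht' : ¬ S.Valid (S.switch i (ω t)) := fun h =>
      ht (by simpa [switch_switch] using S.valid_switch i h)
    rw [S.playProb_eq_zero M₀ N₀ ω t ht, zero_mul]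
    exact S.playProb_eq_zero M₁ N₁ _ t ht'

open Classical in
/-- The expected number of episodes with arm `i` in the game without a special arm. -/
def expectedPulls (M : (S.game none).Rule I) (N : (S.game none).Rule J) (T : ℕ) (i : ι) : ℝ :=
  ∑ ω : Fin T → S.Episode, (S.game none).playProb M N ω *
    ∑ t, if S.armOf (ω t) = i then (1 : ℝ) else 0

/-- The divergence decomposition of bandit theory: given the past, the log-ratio minus the
divergence of one pull times the indicator of arm `i` has mean zero. -/
lemma sum_playProb_mul_logRatio (M : (S.game none).Rule I) (N : (S.game none).Rule J) (T : ℕ)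
    (i : ι) : ∑ ω : Fin T → S.Episode, (S.game none).playProb M N ω * ∑ t, S.logRatio i (ω t) =
      2 * S.gap * Real.log (S.weight false / S.weight true) * S.expectedPulls M N T i := by
  classical
  set κ := 2 * S.gap * Real.log (S.weight false / S.weight true) with hκ
  have h := sum_seqProb_mul_sum_eq_zero (Ω := S.Episode)
    (q := fun t h τ => S.law (M t h) (N t h) τ) (fun t h => S.sum_law _ _)
    (fun τ => S.logRatio i τ - κ * if S.armOf τ = i then (1 : ℝ) else 0) (fun t h => by
      simp_rw [mul_sub, Finset.sum_sub_distrib]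
      rw [S.sum_law_mul_logRatio, ← hκ, armProb, Finset.sum_mul, ← Finset.sum_sub_distrib]
      refine Finset.sum_eq_zero fun τ _ => ?_
      split_ifs <;> ring) T
  rw [expectedPulls, Finset.mul_sum, ← sub_eq_zero, ← Finset.sum_sub_distrib]
  refine Eq.trans (Finset.sum_congr rfl fun ω _ => ?_) h
  rw [Finset.sum_sub_distrib, ← Finset.mul_sum]
  change seqProb (fun t h τ => S.law (M t h) (N t h) τ) T ω * _ -
    κ * (seqProb (fun t h τ => S.law (M t h) (N t h) τ) T ω * _) = _
  rw [mul_sub]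
  congr 1
  rw [mul_left_comm]

/-- Pigeonhole: the expected pulls of all arms add up to `T`, and there are `card ι - 1` arms other
than the base. -/
lemma exists_expectedPulls_le [Fintype ι] (hι : 2 ≤ Fintype.card ι) (M : (S.game none).Rule I)
    (N : (S.game none).Rule J) (T : ℕ) :
    ∃ i, i ≠ S.base ∧ S.expectedPulls M N T i * ((Fintype.card ι : ℝ) - 1) ≤ T := by
  classical
  have hcard : ((Finset.univ.erase S.base).card : ℝ) = (Fintype.card ι : ℝ) - 1 := by
    rw [Finset.card_erase_of_mem (Finset.mem_univ _), Finset.card_univ, Nat.cast_sub (by omega),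
      Nat.cast_one]
  have hne : (Finset.univ.erase S.base).Nonempty := by
    rw [← Finset.card_pos, Finset.card_erase_of_mem (Finset.mem_univ _), Finset.card_univ]
    omega
  have hpos : (0 : ℝ) < (Fintype.card ι : ℝ) - 1 := by
    have : (2 : ℝ) ≤ Fintype.card ι := by exact_mod_cast hι
    linarith
  have hsum : ∑ i ∈ Finset.univ.erase S.base, S.expectedPulls M N T i ≤ T := by
    calc _ ≤ ∑ i, S.expectedPulls M N T i := by
          refine Finset.sum_le_sum_of_subset_of_nonneg (Finset.subset_univ _) fun i _ _ => ?_
          refine Finset.sum_nonneg fun ω _ => mul_nonneg (Game.playProb_nonneg _ _ _ _) ?_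
          exact Finset.sum_nonneg fun t _ => by split_ifs <;> simp
      _ = ∑ ω : Fin T → S.Episode, (S.game none).playProb M N ω * T := by
          unfold expectedPulls
          rw [Finset.sum_comm]
          refine Finset.sum_congr rfl fun ω _ => ?_
          rw [← Finset.mul_sum, Finset.sum_comm]
          simp
      _ = T := by rw [← Finset.sum_mul]; erw [(S.game none).sum_playProb M N T]; rw [one_mul]
  obtain ⟨i, hi, hle⟩ := Finset.exists_le_of_sum_le
    (f := fun i => S.expectedPulls M N T i)
    (g := fun _ => (T : ℝ) / ((Fintype.card ι : ℝ) - 1)) hne (by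
      rw [Finset.sum_const, nsmul_eq_mul, hcard, mul_div_cancel₀ _ hpos.ne']
      exact hsum)
  exact ⟨i, (Finset.mem_erase.1 hi).1, (le_div_iff₀ hpos).1 hle⟩

/-- If every outcome is bad in the game without a special arm or in the game with the special
arm `i`, then the bad event has probability more than `δ` in one of the games, unless there are
many episodes. -/
theorem exists_lt_prob [Fintype ι] (hι : 2 ≤ Fintype.card ι) {T : ℕ} {δ : ℝ} (hδ : 0 < δ)
    (hT : T * (32 * S.gap ^ 2) < ((Fintype.card ι : ℝ) - 1) * Real.log (1 / (4 * δ)))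
    (M : ∀ e, (S.game e).Rule I) (N : ∀ e, (S.game e).Rule J)
    (hM : ∀ i, S.Compatible i (M none) (M (some i)))
    (hN : ∀ i, S.Compatible i (N none) (N (some i)))
    (F : Option ι → (Fin T → S.Episode) → Prop)
    (hF : ∀ i, i ≠ S.base → ∀ ω : Fin T → S.Episode, (∀ t, S.Valid (ω t)) →
      F none ω ∨ F (some i) fun t => S.switch i (ω t)) :
    ∃ e, δ < (S.game e).prob (M e) (N e) T (F e) := by
  classical
  obtain ⟨i, hi, hpulls⟩ := S.exists_expectedPulls_le hι (M none) (N none) T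
  have hK : (0 : ℝ) < (Fintype.card ι : ℝ) - 1 := by
    have : (2 : ℝ) ≤ Fintype.card ι := by exact_mod_cast hι
    linarith
  set p : (Fin T → S.Episode) → ℝ := fun ω => (S.game none).playProb (M none) (N none) ω with hp
  set Λ : (Fin T → S.Episode) → ℝ := fun ω => ∑ t, S.logRatio i (ω t) with hΛ
  have hp0 : ∀ ω, 0 ≤ p ω := fun ω => Game.playProb_nonneg _ _ _ _
  have hp1 : ∑ ω, p ω = 1 := (S.game none).sum_playProb (M none) (N none) T
  let σ : (Fin T → S.Episode) ≃ (Fin T → S.Episode) := Equiv.piCongrRight fun _ => S.switchEquiv i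
  have hσ : ∀ ω, (S.game (some i)).playProb (M (some i)) (N (some i)) (σ ω) =
      p ω * Real.exp (-Λ ω) := fun ω => S.playProb_switch (hM i) (hN i) ω
  have hr1 : ∑ ω, p ω * Real.exp (-Λ ω) = 1 := by
    simp_rw [← hσ]
    rw [σ.sum_comp fun ω => (S.game (some i)).playProb (M (some i)) (N (some i)) ω]
    exact (S.game (some i)).sum_playProb _ _ T
  have hpull0 : 0 ≤ S.expectedPulls (M none) (N none) T i :=
    Finset.sum_nonneg fun ω _ => mul_nonneg (Game.playProb_nonneg _ _ _ _)
      (Finset.sum_nonneg fun t _ => by split_ifs <;> simp)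
  have hB : ∑ ω, p ω * Λ ω ≤ 32 * S.gap ^ 2 * S.expectedPulls (M none) (N none) T i :=
    (S.sum_playProb_mul_logRatio (M none) (N none) T i).trans_le
      (mul_le_mul_of_nonneg_right S.information_le hpull0)
  have hBlt : 32 * S.gap ^ 2 * S.expectedPulls (M none) (N none) T i <
      Real.log (1 / (4 * δ)) := by
    have hg : 0 ≤ 32 * S.gap ^ 2 := by positivity
    have := mul_le_mul_of_nonneg_left hpulls hg
    nlinarith
  have hBH := half_exp_neg_le_sum_add_sum p Λ hp0 hp1 hr1 _ hB (F none)
  -- Bretagnolle–Huber halves this, so the two bad events have total probability above `2 * δ`.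
  have hexp : 4 * δ < Real.exp (-(32 * S.gap ^ 2 * S.expectedPulls (M none) (N none) T i)) := by
    rw [← Real.log_lt_iff_lt_exp (by positivity)]
    rw [one_div, Real.log_inv] at hBlt
    linarith
  have hP1 : (S.game (some i)).prob (M (some i)) (N (some i)) T (F (some i)) =
      ∑ ω, if F (some i) (σ ω) then p ω * Real.exp (-Λ ω) else 0 := by
    simp_rw [← hσ]
    rw [σ.sum_comp fun ω => if F (some i) ω then
      (S.game (some i)).playProb (M (some i)) (N (some i)) ω else 0]
    exact Finset.sum_congr rfl fun ω _ => by congr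
  have hP0 : (S.game none).prob (M none) (N none) T (F none) =
      ∑ ω, if F none ω then p ω else 0 :=
    Finset.sum_congr rfl fun ω _ => by congr
  have hle : ∑ ω, ((if F none ω then p ω else 0) +
      if F none ω then 0 else p ω * Real.exp (-Λ ω)) ≤
      (S.game none).prob (M none) (N none) T (F none) +
        (S.game (some i)).prob (M (some i)) (N (some i)) T (F (some i)) := by
    rw [hP0, hP1, Finset.sum_add_distrib]
    refine add_le_add_right (Finset.sum_le_sum fun ω _ => ?_) _
    have hr : 0 ≤ p ω * Real.exp (-Λ ω) := mul_nonneg (hp0 ω) (Real.exp_nonneg _)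
    by_cases h0 : F none ω
    · rw [if_pos h0]; split_ifs
      · exact hr
      · exact le_rfl
    rw [if_neg h0]
    by_cases hv : ∀ t, S.Valid (ω t)
    · have : F (some i) (σ ω) := (hF i hi ω hv).resolve_left h0
      rw [if_pos this]
    · push Not at hv
      obtain ⟨t, ht⟩ := hv
      have : p ω = 0 := S.playProb_eq_zero (M none) (N none) ω t ht
      simp [this]
  by_contra! hcon
  have h1 := hcon none
  have h2 := hcon (some i)
  linarith

/-! ### Regret and equilibria -/

/-- The factor `sign` turns the difference into the gain of the player for whom the arms are meant.
In this game the base arm beats every other by `gap` per rewarded step. -/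
lemma value_base_sub (hsign : S.sign * S.sign = 1) {μ' : I.Policy} {ν' : J.Policy}
    (h' : S.armProb μ' ν' S.base = 1) (μ : I.Policy) (ν : J.Policy) :
    S.sign * ((S.game none).value μ' ν' - (S.game none).value μ ν) =
      ((H : ℝ) - S.start) * S.gap * (1 - S.armProb μ ν S.base) := by
  rw [S.value_game_none, S.value_game_none, h']
  linear_combination ((H : ℝ) - S.start) * S.gap * (1 - S.armProb μ ν S.base) * hsign

/-- The special arm beats the base by `gap` and the others by `2 * gap` per rewarded step, so the
gain is proportional to `2 - p_base - 2 * p_i`. This is at least `p_base`, because `p_base + p_i ≤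
1`. -/
lemma le_value_special_sub (hsign : S.sign * S.sign = 1) {i : ι} (hi : i ≠ S.base)
    {μ' : I.Policy} {ν' : J.Policy} (h' : S.armProb μ' ν' i = 1) (μ : I.Policy) (ν : J.Policy) :
    ((H : ℝ) - S.start) * S.gap * S.armProb μ ν S.base ≤
      S.sign * ((S.game (some i)).value μ' ν' - (S.game (some i)).value μ ν) := by
  have h0 : S.armProb μ' ν' S.base = 0 := by
    have := S.armProb_add_le hi μ' ν'
    linarith [S.armProb_nonneg μ' ν' S.base]
  have hd : 0 ≤ ((H : ℝ) - S.start) * S.gap := by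
    have : (S.start : ℝ) < H := by exact_mod_cast S.start_lt
    exact mul_nonneg (by linarith) S.gap_pos.le
  have h1 : S.sign * ((S.game (some i)).value μ' ν' - (S.game (some i)).value μ ν) =
      ((H : ℝ) - S.start) * S.gap * (2 - S.armProb μ ν S.base - 2 * S.armProb μ ν i) := by
    rw [S.value_game_some hi, S.value_game_some hi, h', h0]
    linear_combination
      ((H : ℝ) - S.start) * S.gap * (2 - S.armProb μ ν S.base - 2 * S.armProb μ ν i) * hsign
  rw [h1]
  exact mul_le_mul_of_nonneg_left (by linarith [S.armProb_add_le hi μ ν]) hd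

/-- A policy of the max-player with which only the arm `j` is played. -/
def SteersMax (j : ι) (μ : I.Policy) : Prop := ∀ ν, S.armProb μ ν j = 1

/-- A policy of the min-player with which only the arm `j` is played. -/
def SteersMin (j : ι) (ν : J.Policy) : Prop := ∀ μ, S.armProb μ ν j = 1

/-- Against an opponent without choices, every algorithm has large regret in one of the games. -/
theorem exists_regret [Fintype ι] [Subsingleton J.Policy] (hsign : S.sign = 1)
    (hsteer : ∀ j, ∃ μ, S.SteersMax j μ) (hι : 2 ≤ Fintype.card ι) {T : ℕ} {δ : ℝ} (hδ : 0 < δ)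
    (hT : T * (32 * S.gap ^ 2) < ((Fintype.card ι : ℝ) - 1) * Real.log (1 / (4 * δ)))
    (L : MaxAlgorithm H) :
    ∃ G : Game I J, ∀ N : G.Rule J, δ < G.prob (L.rule G) N T fun ω =>
      ((H : ℝ) - S.start) * S.gap * T / 2 ≤ G.regretMax (L.rule G) N ω := by
  let ν₀ : J.Policy := fun _ => Classical.choice inferInstance
  have hs : S.sign * S.sign = 1 := by rw [hsign, one_mul]
  have hM : ∀ i, S.Compatible i (L.rule (S.game none)) (L.rule (S.game (some i))) := by
    intro i t past hpast
    have : (fun u => (S.game (some i)).obsMax (S.switch i (past u))) =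
        fun u => (S.game none).obsMax (past u) :=
      funext fun u => S.obsMax_switch i (hpast u)
    exact congrArg (L I t) this
  obtain ⟨e, he⟩ := S.exists_lt_prob hι hδ hT (fun e => L.rule (S.game e)) (fun e _ _ => ν₀)
    hM (fun _ _ _ _ => rfl) (fun e ω => ((H : ℝ) - S.start) * S.gap * T / 2 ≤
      (S.game e).regretMax (L.rule (S.game e)) (fun _ _ => ν₀) ω) (by
    intro i hi ω hω
    have hd : 0 ≤ ((H : ℝ) - S.start) * S.gap := by
      have : (S.start : ℝ) < H := by exact_mod_cast S.start_lt
      exact mul_nonneg (by linarith) S.gap_pos.le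
    let μ : Fin T → I.Policy := fun t => L.rule (S.game none) t.1 ((S.game none).past ω t)
    -- The same policies `μ t` are played on the switched history. Total weight at most `T / 2` on
    -- the base is costly in `none`, and weight at least `T / 2` is costly in `some i`.
    rcases le_total (∑ t, S.armProb (μ t) ν₀ S.base) ((T : ℝ) / 2) with hle | hle
    · left
      obtain ⟨μ', hμ'⟩ := hsteer S.base
      refine le_trans ?_ ((S.game none).le_regretMax _ _ ω μ')
      have : ∀ t : Fin T, (S.game none).value μ' ν₀ - (S.game none).value (μ t) ν₀ =
          ((H : ℝ) - S.start) * S.gap * (1 - S.armProb (μ t) ν₀ S.base) := fun t => by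
        rw [← S.value_base_sub hs (hμ' ν₀) (μ t) ν₀, hsign, one_mul]
      calc _ ≤ ((H : ℝ) - S.start) * S.gap * (T - ∑ t, S.armProb (μ t) ν₀ S.base) := by
            rw [mul_div_assoc]
            exact mul_le_mul_of_nonneg_left (by linarith) hd
        _ = ∑ t, ((S.game none).value μ' ν₀ - (S.game none).value (μ t) ν₀) := by
            simp_rw [this, ← Finset.mul_sum, Finset.sum_sub_distrib]
            simp
    · right
      obtain ⟨μ', hμ'⟩ := hsteer i
      refine le_trans ?_ ((S.game (some i)).le_regretMax _ _ _ μ')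
      have hμ : ∀ t : Fin T, L.rule (S.game (some i)) t.1
          ((S.game (some i)).past (fun t => S.switch i (ω t)) t) = μ t := fun t =>
        hM i t.1 ((S.game none).past ω t) fun u => hω _
      calc _ ≤ ((H : ℝ) - S.start) * S.gap * ∑ t, S.armProb (μ t) ν₀ S.base := by
            rw [mul_div_assoc]
            exact mul_le_mul_of_nonneg_left hle hd
        _ ≤ ∑ t, ((S.game (some i)).value μ' ν₀ - (S.game (some i)).value (μ t) ν₀) := by
            rw [Finset.mul_sum]
            refine Finset.sum_le_sum fun t _ => ?_
            have := S.le_value_special_sub hs hi (hμ' ν₀) (μ t) ν₀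
            rwa [hsign, one_mul] at this
        _ = _ := Finset.sum_congr rfl fun t _ => by rw [hμ])
  refine ⟨S.game e, fun N => ?_⟩
  -- The min-player has only one policy, so an adaptive choice changes nothing.
  have hN : N = fun _ _ => ν₀ := funext fun t => funext fun past => Subsingleton.elim _ _
  rw [hN]
  exact he

/-- If either player can steer to any arm, then every algorithm with few episodes fails to find an
equilibrium in one of the games. -/
theorem exists_successProb_lt [Fintype ι]
    (hsteer : (S.sign = 1 ∧ ∀ j, ∃ μ, S.SteersMax j μ) ∨ (S.sign = -1 ∧ ∀ j, ∃ ν, S.SteersMin j ν))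
    (hι : 2 ≤ Fintype.card ι) {T : ℕ} {δ ε : ℝ} (hδ : 0 < δ)
    (hε : 2 * ε < ((H : ℝ) - S.start) * S.gap)
    (hT : T * (32 * S.gap ^ 2) < ((Fintype.card ι : ℝ) - 1) * Real.log (1 / (4 * δ)))
    (L : JointAlgorithm H) : ∃ G : Game I J, L.successProb G T ε < 1 - δ := by
  have hs : S.sign * S.sign = 1 := by
    rcases hsteer with h | h <;> rw [h.1] <;> norm_num
  have hprof : ∀ i t (past : Fin t → S.Episode), (∀ u, S.Valid (past u)) →
      L.profile (S.game (some i)) t (fun u => S.switch i (past u)) =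
        L.profile (S.game none) t past := by
    intro i t past hpast
    have : (fun u => (S.game (some i)).obsBoth (S.switch i (past u))) =
        fun u => (S.game none).obsBoth (past u) :=
      funext fun u => S.obsBoth_switch i (hpast u)
    exact congrArg (L I J t) this
  have hdev : ∀ (G : Game I J) (j : ι) (μ : I.Policy) (ν : J.Policy),
      (∀ μ' ν', S.armProb μ' ν' j = 1 → ε < S.sign * (G.value μ' ν' - G.value μ ν)) →
      ¬ G.IsEpsNash ε μ ν := by
    intro G j μ ν h hnash
    rcases hsteer with ⟨h1, h2⟩ | ⟨h1, h2⟩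
    · obtain ⟨μ', hμ'⟩ := h2 j
      have := h μ' ν (hμ' ν)
      have := hnash.1 μ'
      rw [h1] at *
      linarith
    · obtain ⟨ν', hν'⟩ := h2 j
      have := h μ ν' (hν' μ)
      have := hnash.2 ν'
      rw [h1] at *
      linarith
  obtain ⟨e, he⟩ := S.exists_lt_prob hι hδ hT
    (fun e t past => (L.profile (S.game e) t past).1)
    (fun e t past => (L.profile (S.game e) t past).2)
    (fun i t past hpast => congrArg Prod.fst (hprof i t past hpast))
    (fun i t past hpast => congrArg Prod.snd (hprof i t past hpast))
    (fun e ω => ¬ (S.game e).IsEpsNash ε (L.profile (S.game e) T ω).1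
      (L.profile (S.game e) T ω).2) (by
    intro i hi ω hω
    have hd : 0 < ((H : ℝ) - S.start) * S.gap := by
      have : (S.start : ℝ) < H := by exact_mod_cast S.start_lt
      exact mul_pos (by linarith) S.gap_pos
    rw [hprof i T ω hω]
    set P := L.profile (S.game none) T ω
    -- Either way a deviation gains at least half of `(H - start) * gap`, which exceeds `ε`.
    rcases le_total (S.armProb P.1 P.2 S.base) (1 / 2) with hle | hle
    · left
      refine hdev _ S.base _ _ fun μ' ν' h' => ?_
      rw [S.value_base_sub hs h']
      nlinarith
    · right
      refine hdev _ i _ _ fun μ' ν' h' => ?_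
      refine lt_of_lt_of_le ?_ (S.le_value_special_sub hs hi h' _ _)
      nlinarith)
  refine ⟨S.game e, ?_⟩
  rw [Game.prob_not] at he
  rw [JointAlgorithm.successProb]
  linarith

end BitSetup

/-! ### Trees of action sequences -/

namespace PathTree

variable {H : ℕ}

/-- A choice of one of `c i` actions at every step `i`. -/
abbrev Plan (c : Fin H → ℕ) : Type := (i : Fin H) → Fin (c i)

/-- Every information set has `A` actions. -/
def constant (H A : ℕ) : Fin H → ℕ := fun _ => A

instance (A : ℕ) [NeZero A] (i : Fin H) : NeZero (constant H A i) := ‹NeZero A›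

lemma card_plan_constant (A : ℕ) : Fintype.card (Plan (constant H A)) = A ^ H := by
  rw [Fintype.card_pi, Finset.prod_congr rfl fun i _ => Fintype.card_fin (constant H A i)]
  exact (Finset.prod_const A).trans (by simp)

/-- Only the information sets of step `s` have more than one action. -/
def single (H s K : ℕ) : Fin H → ℕ := fun i => if i.1 = s then K else 1

instance (s K : ℕ) [NeZero K] (i : Fin H) : NeZero (single H s K i) := by
  unfold single; split_ifs <;> infer_instance

lemma single_eq_one {s K : ℕ} (i : Fin H) (h : s < i.1) : single H s K i = 1 :=
  if_neg h.ne'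

lemma prod_single_of_mem {s K : ℕ} (h : Fin H) (hs : s < h.1) :
    (∏ i : Fin H, if i < h then single H s K i else 1) = K := by
  rw [Finset.prod_eq_single (⟨s, hs.trans h.2⟩ : Fin H)]
  · rw [if_pos (by rw [Fin.lt_def]; exact hs)]; simp [single]
  · intro i _ hi
    have : i.1 ≠ s := fun h' => hi (Fin.ext h')
    simp [single, this]
  · simp

lemma prod_single_of_notMem {s K : ℕ} (h : Fin H) (hs : h.1 ≤ s) :
    (∏ i : Fin H, if i < h then single H s K i else 1) = 1 := by
  refine Finset.prod_eq_one fun i _ => ?_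
  split_ifs with hi
  · rw [Fin.lt_def] at hi
    exact if_neg (by omega)
  · rfl

lemma card_plan_single {s : ℕ} (hs : s < H) (K : ℕ) : Fintype.card (Plan (single H s K)) = K := by
  rw [Fintype.card_pi, Finset.prod_eq_single (⟨s, hs⟩ : Fin H)]
  · simp [single]
  · intro i _ hi
    have : i.1 ≠ s := fun h' => hi (Fin.ext h')
    simp [single, this]
  · simp

variable [NeZero H] (c : Fin H → ℕ) [∀ i, NeZero (c i)] (E : ℕ)

/-- The initial segments of plans (padded with zeros), together with `E` additional information
sets of the last step. -/
abbrev Node : Type := {p : Fin H × Plan c // ∀ i, p.1 ≤ i → p.2 i = 0} ⊕ Fin E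

variable {c E}

/-- The step of an information set. -/
def level (x : Node c E) : Fin H := x.elim (fun p => p.1.1) fun _ => BitSetup.lastStep H

/-- The past actions at an information set. -/
def plan (x : Node c E) : Plan c := x.elim (fun p => p.1.2) fun _ => 0

lemma plan_eq_zero (x : Node c E) (i : Fin H) (h : level x ≤ i) : plan x i = 0 := by
  rcases x with ⟨p, hp⟩ | x
  · exact hp i h
  · rfl

/-- The previous step. -/
def prevLevel (x : Node c E) : Fin H := ⟨(level x).1 - 1, by omega⟩

/-- The previous information set. -/
def prev (x : Node c E) : Node c E :=
  Sum.inl ⟨(prevLevel x, Function.update (plan x) (prevLevel x) 0), fun i hi => by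
    dsimp only at hi ⊢
    by_cases h : i = prevLevel x
    · subst h; exact Function.update_self _ _ _
    · rw [Function.update_of_ne h]
      refine plan_eq_zero x i ?_
      rw [Fin.le_def] at hi ⊢
      have h' : i.1 ≠ (level x).1 - 1 := fun h'' => h (Fin.ext h'')
      have : (prevLevel x).1 = (level x).1 - 1 := rfl
      omega⟩

/-- The information set reached by an action. -/
def next (x : Node c E) (a : Fin (c (level x))) : Node c E :=
  if h : (level x).1 + 1 < H then
    Sum.inl ⟨(⟨(level x).1 + 1, h⟩, Function.update (plan x) (level x) a), fun i hi => by
      rw [Fin.le_def] at hi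
      dsimp only at hi ⊢
      rw [Function.update_of_ne (fun h' => by subst h'; omega)]
      exact plan_eq_zero x i (by rw [Fin.le_def]; omega)⟩
  else x

lemma level_next (x : Node c E) (a : Fin (c (level x))) (h : (level x).1 + 1 < H) :
    (level (next x a)).1 = (level x).1 + 1 := by
  rw [next, dif_pos h]; rfl

lemma plan_next (x : Node c E) (a : Fin (c (level x))) (h : (level x).1 + 1 < H) :
    plan (next x a) = Function.update (plan x) (level x) a := by
  rw [next, dif_pos h]; rfl

/-- The plan up to a given action. -/
def planWith (p : Σ x : Node c E, Fin (c (level x))) : Plan c :=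
  Function.update (plan p.1) (level p.1) p.2

/-- Steps after `start` offer one action each, so extending the path does not alter the plan. -/
lemma planWith_next {start : ℕ} (hc : ∀ i : Fin H, start < i.1 → c i = 1) (x : Node c E)
    (a : Fin (c (level x))) (a' : Fin (c (level (next x a)))) (hs : start ≤ (level x).1)
    (h : (level x).1 + 1 < H) : planWith ⟨next x a, a'⟩ = planWith ⟨x, a⟩ := by
  unfold planWith
  rw [plan_next x a h]
  funext j
  by_cases hj : j = level (next x a)
  · have h1 : c j = 1 := hc j (by rw [hj, level_next x a h]; omega)
    have : Subsingleton (Fin (c j)) := by rw [h1]; infer_instance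
    exact Subsingleton.elim _ _
  · exact Function.update_of_ne hj _ _

variable (c E)

/-- The information-set structure of a player who remembers a sequence of actions. -/
@[reducible] def pathTree : InfoTree H where
  Node := Node c E
  Act x := Fin (c (level x))
  depth x := (level x).1
  depth_lt x := (level x).2
  -- Step `0` has no parent, so the truncated subtraction in `prevLevel` is harmless. When `1 < H`,
  -- an additional information set gets the parent of the all-zero path; no transition leads to it.
  parent x := if (level x).1 = 0 then none else some ⟨prev x, plan x (prevLevel x)⟩
  depth_root x h := by
    by_contra h0
    rw [if_neg h0] at h
    cases h
  depth_child x p h := by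
    by_cases h0 : (level x).1 = 0
    · rw [if_pos h0] at h; cases h
    · rw [if_neg h0, Option.some.injEq] at h
      subst h
      exact (Nat.succ_pred_eq_of_ne_zero h0).symm

/-- The initial information set and the successors in a tree of action sequences. -/
def succession : (pathTree c E).Succession where
  root := Sum.inl ⟨(0, 0), fun _ _ => rfl⟩
  parent_root := rfl
  child := next
  parent_child x a h := by
    rcases x with ⟨⟨l, v⟩, hv⟩ | x
    · change l.1 + 1 < H at h
      change Fin (c l) at a
      -- Pairs with dependent actions are compared through equalities of plans and actions.
      -- Truncating the extended plan gives back `v`, which vanishes from step `l` on.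
      have key : ∀ (w : Plan c) (hw : ∀ i, l ≤ i → w i = 0) (b : Fin (c l)), w = v → b = a →
          (⟨Sum.inl ⟨(l, w), hw⟩, b⟩ : Σ x : Node c E, Fin (c (level x))) =
            ⟨Sum.inl ⟨(l, v), hv⟩, a⟩ := by
        rintro w hw b rfl rfl; rfl
      have hn : next (Sum.inl ⟨(l, v), hv⟩ : Node c E) a =
          Sum.inl ⟨(⟨l.1 + 1, h⟩, Function.update v l a), fun i hi => by
            rw [Fin.le_def] at hi
            dsimp only at hi ⊢
            rw [Function.update_of_ne (fun h' => by subst h'; omega)]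
            exact hv i (by rw [Fin.le_def]; dsimp only; omega)⟩ := dif_pos h
      rw [hn]
      change some _ = some _
      refine congrArg some (key (Function.update (Function.update v l a) l 0) ?_ _ ?_ ?_)
      · rw [Function.update_idem]
        intro i hi
        by_cases hil : i = l
        · subst hil; exact Function.update_self _ _ _
        · rw [Function.update_of_ne hil]; exact hv i hi
      · rw [Function.update_idem, Function.update_eq_self_iff]
        exact (hv l le_rfl).symm
      · exact Function.update_self l a v
    · exfalso
      have : (level (Sum.inr x : Node c E)).1 = H - 1 := rfl
      change (level (Sum.inr x : Node c E)).1 + 1 < H at h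
      have := NeZero.pos H
      omega

variable {c E}

/-- A path on which all actions are those of the plan `j` is a realization of `j`. -/
lemma planWith_eq_of_follows (j : Plan c) (p : Fin H → Σ x : Node c E, Fin (c (level x)))
    (h0 : (p 0).1 = (succession c E).root)
    (h1 : ∀ (h : Fin H) (hh : h.1 + 1 < H), (p ⟨h.1 + 1, hh⟩).1 = next (p h).1 (p h).2)
    (h2 : ∀ h, (p h).2 = j (level (p h).1)) : planWith (p (BitSetup.lastStep H)) = j := by
  have key : ∀ (h : ℕ) (hh : h < H), (level (p ⟨h, hh⟩).1).1 = h ∧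
      ∀ i : Fin H, i.1 < h → plan (p ⟨h, hh⟩).1 i = j i := by
    intro h
    induction h with
    | zero =>
      intro hh
      have : (⟨0, hh⟩ : Fin H) = 0 := rfl
      rw [this, h0]
      exact ⟨rfl, fun i hi => absurd hi (Nat.not_lt_zero _)⟩
    | succ h ih =>
      intro hh
      obtain ⟨ih1, ih2⟩ := ih (by omega)
      have hl : (level (p ⟨h, by omega⟩).1).1 + 1 < H := by rw [ih1]; exact hh
      rw [h1 ⟨h, by omega⟩ hh, level_next _ _ hl, plan_next _ _ hl]
      refine ⟨by rw [ih1], fun i hi => ?_⟩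
      by_cases hi' : i = level (p ⟨h, by omega⟩).1
      · rw [hi', Function.update_self, h2]
      · rw [Function.update_of_ne hi']
        refine ih2 i ?_
        have : i.1 ≠ h := fun h' => hi' (Fin.ext (h'.trans ih1.symm))
        omega
  obtain ⟨k1, k2⟩ := key (H - 1) (BitSetup.lastStep H).2
  unfold planWith
  funext i
  by_cases hi : i = level (p (BitSetup.lastStep H)).1
  · rw [hi, Function.update_self, h2]
  · rw [Function.update_of_ne hi]
    refine k2 i ?_
    have : i.1 ≠ H - 1 := fun h' => hi (Fin.ext (h'.trans k1.symm))
    have := i.2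
    omega

/-- The policy that follows the plan `j`. -/
def follow (j : Plan c) : (pathTree c E).Policy := fun x =>
  ⟨Pi.single (j (level x)) 1, single_mem_stdSimplex ℝ _⟩

lemma eq_of_follow_ne_zero {j : Plan c} {x : Node c E} {a : Fin (c (level x))}
    (h : (follow j : (pathTree c E).Policy) x a ≠ 0) : a = j (level x) := by
  by_contra hne
  exact h (Pi.single_eq_of_ne hne _)

/-! ### The numbers of information sets and actions -/

/-- An initial segment of length `h` is a free choice of the coordinates below `h`, which gives the
product; the `E` additional sets sit at the last step. -/
lemma sum_level (f : Fin H → ℕ) :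
    ∑ x : Node c E, f (level x) =
      ∑ h : Fin H, (∏ i : Fin H, if i < h then c i else 1) * f h + E * f (BitSetup.lastStep H) := by
  have hw : ∀ h : Fin H, Fintype.card {v : Plan c // ∀ i, h ≤ i → v i = 0} =
      ∏ i : Fin H, if i < h then c i else 1 := by
    intro h
    rw [Fintype.card_subtype]
    have : (Finset.univ.filter fun v : Plan c => ∀ i, h ≤ i → v i = 0) =
        Fintype.piFinset fun i => if i < h then Finset.univ else {0} := by
      ext v
      simp only [Finset.mem_filter, Finset.mem_univ, true_and, Fintype.mem_piFinset]
      refine forall_congr' fun i => ?_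
      by_cases hi : i < h
      · simp [hi]
      · simp [hi, not_lt.1 hi]
    rw [this, Fintype.card_piFinset]
    refine Finset.prod_congr rfl fun i _ => ?_
    split_ifs <;> simp
  rw [Fintype.sum_sum_type]
  congr 1
  · change ∑ p : {p : Fin H × Plan c // ∀ i, p.1 ≤ i → p.2 i = 0}, f p.1.1 = _
    rw [← (Equiv.subtypeProdEquivSigmaSubtype
      fun (h : Fin H) (v : Plan c) => ∀ i, h ≤ i → v i = 0).symm.sum_comp, Fintype.sum_sigma]
    refine Finset.sum_congr rfl fun h _ => ?_
    change ∑ _v : {v : Plan c // ∀ i, h ≤ i → v i = 0}, f h = _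
    rw [Finset.sum_const, Finset.card_univ, hw, smul_eq_mul]
  · change ∑ _x : Fin E, f (BitSetup.lastStep H) = _
    simp

lemma hasFixedSize_constant (A : ℕ) [NeZero A] : (pathTree (constant H A) E).HasFixedSize A :=
  fun x => Fintype.card_fin (constant H A (level x))

lemma numInfoSets_constant (A : ℕ) [NeZero A] :
    (pathTree (constant H A) E).numInfoSets = treeSize A H + E := by
  have h := sum_level (c := constant H A) (E := E) fun _ => 1
  rw [← Finset.card_eq_sum_ones, Finset.card_univ] at h
  rw [InfoTree.numInfoSets]
  refine h.trans ?_
  rw [treeSize, ← Fin.sum_univ_eq_sum_range, mul_one]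
  congr 1
  refine Finset.sum_congr rfl fun k _ => ?_
  simp only [constant, mul_one, Finset.prod_ite, Finset.prod_const, one_pow]
  congr 1
  rw [Finset.filter_gt_eq_Iio, Fin.card_Iio]

/-- The tree is a path up to step `s` and then splits into `K` paths. An additional set has one
action, unless the choice is made at the last step. -/
lemma numActions_single {s : ℕ} (hs : s < H) (K : ℕ) [NeZero K] :
    (pathTree (single H s K) E).numActions =
      s + K * (H - s) + E * if H - 1 = s then K else 1 := by
  have h := sum_level (c := single H s K) (E := E) (single H s K)
  have h1 : (pathTree (single H s K) E).numActions =
      ∑ x : Node (single H s K) E, single H s K (level x) :=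
    Finset.sum_congr rfl fun x _ => Fintype.card_fin _
  rw [h1, h]
  congr 1
  have h2 : ∀ k : Fin H, (∏ i : Fin H, if i < k then single H s K i else 1) * single H s K k =
      if k.1 < s then 1 else K := by
    intro k
    rcases lt_trichotomy k.1 s with hk | hk | hk
    · rw [prod_single_of_notMem k hk.le, if_pos hk, single, if_neg hk.ne]
    · rw [prod_single_of_notMem k hk.le, if_neg hk.not_lt, single, if_pos hk, one_mul]
    · rw [prod_single_of_mem k hk, if_neg (by omega), single, if_neg hk.ne', mul_one]
  simp_rw [h2]
  rw [Fin.sum_univ_eq_sum_range (fun k => if k < s then 1 else K) H, Finset.sum_ite,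
    Finset.sum_const, Finset.sum_const]
  have e1 : (Finset.range H).filter (fun k => k < s) = Finset.range s := by ext k; simp; omega
  have e2 : (Finset.range H).filter (fun k => ¬ k < s) = Finset.Ico s H := by ext k; simp; omega
  rw [e1, e2, Finset.card_range, Nat.card_Ico, smul_eq_mul, smul_eq_mul, mul_one, mul_comm K]

/-- This tree serves as the opponent without choices. -/
instance (s : ℕ) : Subsingleton (pathTree (single H s 1) E).Policy := by
  refine ⟨fun μ ν => funext fun x => Subtype.ext (funext fun a => ?_)⟩
  have hsub : Subsingleton (Fin (single H s 1 (level x))) := by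
    have : single H s 1 (level x) = 1 := by simp [single]
    rw [this]; infer_instance
  have h1 : ∑ b, (μ x).1 b = 1 := (μ x).2.2
  have h2 : ∑ b, (ν x).1 b = 1 := (ν x).2.2
  rw [Fintype.sum_subsingleton _ a] at h1 h2
  rw [h1, h2]

end PathTree

/-! ### The lower bounds on trees of action sequences -/

namespace PathTree

variable {H : ℕ} [NeZero H] {c c' : Fin H → ℕ} [∀ i, NeZero (c i)] [∀ i, NeZero (c' i)] {E E' : ℕ}
  {start : ℕ} {gap : ℝ}

/-- The games in which the plan of the max-player is the arm. -/
def maxSetup (hs : start < H) (hc : ∀ i : Fin H, start < i.1 → c i = 1) (hgap : 0 < gap)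
    (hgap' : gap ≤ 3 / 8) : BitSetup (pathTree c E) (pathTree c' E') (Plan c) where
  left := succession c E
  right := succession c' E'
  arm p _ := planWith p
  start := start
  start_lt := hs
  arm_child x a _ _ a' _ _ h1 h2 := planWith_next hc x a a' h1 h2
  base := 0
  sign := 1
  sign_mem := by simp
  gap := gap
  gap_pos := hgap
  gap_le := hgap'

/-- The games in which the plan of the min-player is the arm. -/
def minSetup (hs : start < H) (hc : ∀ i : Fin H, start < i.1 → c' i = 1) (hgap : 0 < gap)
    (hgap' : gap ≤ 3 / 8) : BitSetup (pathTree c E) (pathTree c' E') (Plan c') where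
  left := succession c E
  right := succession c' E'
  arm _ q := planWith q
  start := start
  start_lt := hs
  arm_child _ _ y b _ b' h h1 h2 :=
    planWith_next hc y b b' (h1.trans_eq h) (by rwa [h] at h2)
  base := 0
  sign := -1
  sign_mem := by simp
  gap := gap
  gap_pos := hgap
  gap_le := hgap'

lemma valid_succ_infosets {ι : Type} {S : BitSetup (pathTree c E) (pathTree c' E') ι} {τ : S.Episode}
    (hτ : S.Valid τ) (h : Fin H) (hh : h.1 + 1 < H) :
    (τ ⟨h.1 + 1, hh⟩).1.1.1.1 = S.left.child (τ h).1.1.1.1 (τ h).2.1 ∧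
      (τ ⟨h.1 + 1, hh⟩).1.1.1.2 = S.right.child (τ h).1.1.1.2 (τ h).2.2 := by
  have hd := (hτ.depth_and_bit h.1 h.2).1
  rw [hτ.2 h hh, BitSetup.next, dif_pos (by rw [hd]; exact hh)]
  exact ⟨rfl, rfl⟩

lemma steersMax (hs : start < H) (hc : ∀ i : Fin H, start < i.1 → c i = 1) (hgap : 0 < gap)
    (hgap' : gap ≤ 3 / 8) (j : Plan c) :
    (maxSetup hs hc hgap hgap' : BitSetup (pathTree c E) (pathTree c' E') _).SteersMax j
      (follow j) := by
  intro ν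
  refine BitSetup.armProb_eq_one _ fun τ hτ => ?_
  have hv := BitSetup.valid_of_law_ne_zero _ hτ
  refine planWith_eq_of_follows j (fun h => ⟨(τ h).1.1.1.1, (τ h).2.1⟩) ?_
    (fun h hh => (valid_succ_infosets hv h hh).1) fun h =>
      eq_of_follow_ne_zero (BitSetup.policy_ne_zero_of_law_ne_zero _ hτ h).1
  exact congrArg (fun p => p.1.1) hv.1

lemma steersMin (hs : start < H) (hc : ∀ i : Fin H, start < i.1 → c' i = 1) (hgap : 0 < gap)
    (hgap' : gap ≤ 3 / 8) (j : Plan c') :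
    (minSetup hs hc hgap hgap' : BitSetup (pathTree c E) (pathTree c' E') _).SteersMin j
      (follow j) := by
  intro μ
  refine BitSetup.armProb_eq_one _ fun τ hτ => ?_
  have hv := BitSetup.valid_of_law_ne_zero _ hτ
  refine planWith_eq_of_follows j (fun h => ⟨(τ h).1.1.1.2, (τ h).2.2⟩) ?_
    (fun h hh => (valid_succ_infosets hv h hh).2) fun h =>
      eq_of_follow_ne_zero (BitSetup.policy_ne_zero_of_law_ne_zero _ hτ h).2
  exact congrArg (fun p => p.1.2) hv.1

lemma log_pos_of_lt {δ : ℝ} (hδ : 0 < δ) (hδ' : δ < 1 / 4) : 0 < Real.log (1 / (4 * δ)) :=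
  Real.log_pos ((one_lt_div (by positivity)).2 (by linarith))

/-- The regret bound for a player with `Fintype.card (Plan c)` plans. -/
theorem exists_regret [Subsingleton (pathTree c' E').Policy] (hs : start < H)
    (hc : ∀ i : Fin H, start < i.1 → c i = 1) (hK : 2 ≤ Fintype.card (Plan c)) {T : ℕ} {δ : ℝ}
    (hδ : 0 < δ) (hδ' : δ < 1 / 4)
    (hT : 0.2 * (Fintype.card (Plan c) : ℝ) * Real.log (1 / (4 * δ)) ≤ T) (L : MaxAlgorithm H) :
    ∃ G : Game (pathTree c E) (pathTree c' E'), ∀ N : G.Rule _, δ < G.prob (L.rule G) N T fun ω =>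
      ((H : ℝ) - start) * √((Fintype.card (Plan c) : ℝ) * T * Real.log (1 / (4 * δ))) / 20 ≤
        G.regretMax (L.rule G) N ω := by
  set l := Real.log (1 / (4 * δ)) with hl
  set K : ℝ := (Fintype.card (Plan c) : ℝ) with hKdef
  have hl0 : 0 < l := log_pos_of_lt hδ hδ'
  have hK2 : (2 : ℝ) ≤ K := by rw [hKdef]; exact_mod_cast hK
  have hT0 : (0 : ℝ) < T := lt_of_lt_of_le (by positivity) hT
  have hratio : K * l / T ≤ 5 := by
    rw [div_le_iff₀ hT0]; nlinarith
  have hpos : 0 < K * l / T := by positivity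
  -- This is the bandit scale. The lower bound on `T` keeps it at most `3 / 8`, and the information
  -- `0.32 * K * l` stays below `(K - 1) * l` because `K ≥ 2`.
  have hgap : 0 < √(K * l / T) / 10 := by positivity
  have hsq : (√(K * l / T)) ^ 2 = K * l / T := Real.sq_sqrt hpos.le
  have hgap' : √(K * l / T) / 10 ≤ 3 / 8 := by
    have : √(K * l / T) ≤ 3 := Real.sqrt_le_iff.2 ⟨by norm_num, by linarith⟩
    linarith
  let S : BitSetup (pathTree c E) (pathTree c' E') (Plan c) := maxSetup hs hc hgap hgap'
  have hinfo : T * (32 * S.gap ^ 2) < (K - 1) * l := by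
    change T * (32 * (√(K * l / T) / 10) ^ 2) < (K - 1) * l
    rw [div_pow, hsq]
    have : T * (32 * (K * l / T / 10 ^ 2)) = 0.32 * (K * l) := by field_simp; norm_num
    rw [this]
    nlinarith
  obtain ⟨G, hG⟩ := S.exists_regret rfl (fun j => ⟨_, steersMax hs hc hgap hgap' j⟩) hK hδ hinfo L
  refine ⟨G, fun N => (hG N).trans_le (G.prob_mono _ _ fun ω hω => le_trans (le_of_eq ?_) hω)⟩
  change _ = ((H : ℝ) - start) * (√(K * l / T) / 10) * T / 2
  have : √(K * T * l) = √(K * l / T) * T := by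
    have e : K * T * l = K * l / T * T ^ 2 := by field_simp
    rw [e, Real.sqrt_mul hpos.le, Real.sqrt_sq hT0.le]
  rw [this]
  ring

/-- With `gap = 3 * ε / d` the information is `288 * ε ^ 2 * T / d ^ 2`, and `288 / 600 < 1 / 2 ≤ (K
- 1) / K`. -/
lemma sample_bound {T : ℕ} {K d ε l : ℝ} (hd : 0 < d)
    (hT : (T : ℝ) < K * d ^ 2 * l / (600 * ε ^ 2)) (hε : 0 < ε) (hK : 2 ≤ K) (hl : 0 < l) :
    T * (32 * (3 * ε / d) ^ 2) < (K - 1) * l := by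
  rw [lt_div_iff₀ (by positivity)] at hT
  have h1 : T * (32 * (3 * ε / d) ^ 2) = T * (288 * ε ^ 2) / d ^ 2 := by field_simp; ring
  rw [h1, div_lt_iff₀ (by positivity)]
  have h2 : 0 < d ^ 2 * l := by positivity
  nlinarith

/-- The sample complexity bound for games in which the plan of one of the players is the arm. -/
theorem exists_sample (K : ℕ) (hs : start < H) (hK : 2 ≤ K)
    (hcK : ((∀ i : Fin H, start < i.1 → c i = 1) ∧ Fintype.card (Plan c) = K) ∨
      ((∀ i : Fin H, start < i.1 → c' i = 1) ∧ Fintype.card (Plan c') = K)) {δ ε : ℝ}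
    (hδ : 0 < δ) (hδ' : δ < 1 / 4) (hε : 0 < ε) (hε' : ε ≤ ((H : ℝ) - start) / 8) (T : ℕ)
    (L : JointAlgorithm H) : ∃ G : Game (pathTree c E) (pathTree c' E'),
      1 - δ ≤ L.successProb G T ε →
        (K : ℝ) * ((H : ℝ) - start) ^ 2 * Real.log (1 / (4 * δ)) / (600 * ε ^ 2) ≤ T := by
  have hd : 0 < (H : ℝ) - start := sub_pos.2 (by exact_mod_cast hs)
  have hgap : 0 < 3 * ε / ((H : ℝ) - start) := by positivity
  have hgap' : 3 * ε / ((H : ℝ) - start) ≤ 3 / 8 := by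
    rw [div_le_iff₀ hd]; linarith
  have hε2 : 2 * ε < ((H : ℝ) - start) * (3 * ε / ((H : ℝ) - start)) := by
    rw [mul_div_cancel₀ _ hd.ne']; linarith
  have hK2 : (2 : ℝ) ≤ K := by exact_mod_cast hK
  rcases hcK with ⟨hc, hcard⟩ | ⟨hc, hcard⟩
  · let S : BitSetup (pathTree c E) (pathTree c' E') (Plan c) := maxSetup hs hc hgap hgap'
    by_cases hT : (K : ℝ) * ((H : ℝ) - start) ^ 2 * Real.log (1 / (4 * δ)) / (600 * ε ^ 2) ≤ T
    · exact ⟨S.game none, fun _ => hT⟩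
    obtain ⟨G, hG⟩ := S.exists_successProb_lt
      (Or.inl ⟨rfl, fun j => ⟨_, steersMax hs hc hgap hgap' j⟩⟩) (hcard ▸ hK) hδ hε2
      (by rw [hcard]; exact sample_bound hd (not_le.1 hT) hε hK2 (log_pos_of_lt hδ hδ')) L
    exact ⟨G, fun h => absurd hG (not_lt.2 h)⟩
  · let S : BitSetup (pathTree c E) (pathTree c' E') (Plan c') := minSetup hs hc hgap hgap'
    by_cases hT : (K : ℝ) * ((H : ℝ) - start) ^ 2 * Real.log (1 / (4 * δ)) / (600 * ε ^ 2) ≤ T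
    · exact ⟨S.game none, fun _ => hT⟩
    obtain ⟨G, hG⟩ := S.exists_successProb_lt
      (Or.inr ⟨rfl, fun j => ⟨_, steersMin hs hc hgap hgap' j⟩⟩) (hcard ▸ hK) hδ hε2
      (by rw [hcard]; exact sample_bound hd (not_le.1 hT) hε hK2 (log_pos_of_lt hδ hδ')) L
    exact ⟨G, fun h => absurd hG (not_lt.2 h)⟩

/-- A tree with a prescribed number of actions and a single step with a choice, after which there
remain many steps. -/
lemma exists_single (n : ℕ) (hn : H < n) : ∃ (K s E : ℕ) (_ : NeZero K), 2 ≤ K ∧ s < H ∧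
    (pathTree (single H s K) E).numActions = n ∧ K ≤ 2 * (n / H) ∧
    effSize n H ≤ 2 * K * ((H : ℝ) - s) ^ 2 ∧ min ((n : ℝ) - H) H ≤ (H : ℝ) - s := by
  have hH : 0 < H := NeZero.pos H
  by_cases h2 : 2 * H ≤ n
  · have hK : 2 ≤ n / H := (Nat.le_div_iff_mul_le hH).2 h2
    have hK0 : NeZero (n / H) := ⟨by omega⟩
    -- The choice is at the first step: `n / H` paths of length `H`, and the remainder as additional
    -- sets with one action each. For `H = 1` the remainder is zero.
    refine ⟨n / H, 0, n % H, hK0, hK, hH, ?_, by omega, ?_, ?_⟩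
    · rw [numActions_single hH]
      have hdm := Nat.div_add_mod n H
      by_cases h1 : H - 1 = 0
      · have : H = 1 := by omega
        subst this
        simp [Nat.mod_one]
      · rw [if_neg h1]
        simp only [zero_add, Nat.sub_zero, mul_one]
        rw [mul_comm]; exact hdm
    · have h3 : n < (n / H + 1) * H := by
        rw [mul_comm]; exact Nat.lt_mul_div_succ n hH
      have h4 : (n : ℝ) < (((n / H : ℕ) : ℝ) + 1) * H := by exact_mod_cast h3
      have h5 : (2 : ℝ) ≤ ((n / H : ℕ) : ℝ) := by exact_mod_cast hK
      have h6 : (0 : ℝ) < H := by exact_mod_cast hH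
      have h7 : (H : ℝ) < n := by exact_mod_cast hn
      unfold effSize
      calc ((n : ℝ) - H) * min ((n : ℝ) - H) H ≤ ((n : ℝ) - H) * H :=
            mul_le_mul_of_nonneg_left (min_le_right _ _) (by linarith)
        _ ≤ (2 * ((n / H : ℕ) : ℝ) * H) * H :=
            mul_le_mul_of_nonneg_right (by nlinarith) h6.le
        _ = _ := by push_cast; ring
    · simp
  · have hq : n / H = 1 := Nat.div_eq_of_lt_le (by omega) (by omega)
    have hcast : ((2 * H - n : ℕ) : ℝ) = 2 * H - n := by
      rw [Nat.cast_sub (by omega)]; push_cast; ring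
    have h7 : (H : ℝ) < n := by exact_mod_cast hn
    -- Too few actions for two full paths: a binary choice at step `s = 2 * H - n` gives `s + 2 * (H
    -- - s) = n` actions and leaves `H - s = n - H` rewarded steps.
    refine ⟨2, 2 * H - n, 0, inferInstance, le_rfl, by omega, ?_, by omega, ?_, ?_⟩
    · rw [numActions_single (by omega)]; omega
    · rw [hcast]
      unfold effSize
      have := mul_le_mul_of_nonneg_left (min_le_left ((n : ℝ) - H) H)
        (by linarith : 0 ≤ (n : ℝ) - H)
      push_cast
      nlinarith [sq_nonneg ((n : ℝ) - H)]
    · rw [hcast]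
      exact (min_le_left _ _).trans (by linarith)

/-- A tree with a prescribed number of actions. -/
lemma exists_numActions (n : ℕ) (hn : H ≤ n) :
    ∃ (K : ℕ) (_ : NeZero K), (pathTree (single H (H - 1) K) 0).numActions = n := by
  have hH : 0 < H := NeZero.pos H
  have hK0 : NeZero (n - (H - 1)) := ⟨by omega⟩
  refine ⟨n - (H - 1), hK0, ?_⟩
  rw [numActions_single (by omega)]
  have : H - (H - 1) = 1 := by omega
  rw [this]
  omega

end PathTree

/-! ### Arithmetic of the sizes, and the four lower bounds -/

lemma effSize_mono {H k n : ℕ} (hk : H ≤ k) (hkn : k ≤ n) : effSize k H ≤ effSize n H := by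
  have h1 : (H : ℝ) ≤ k := by exact_mod_cast hk
  have h2 : (k : ℝ) ≤ n := by exact_mod_cast hkn
  refine mul_le_mul (by linarith) (min_le_min_right _ (by linarith)) ?_ (by linarith)
  exact le_min (by linarith) (Nat.cast_nonneg _)

/-- The last level dominates a geometric sum: fewer than `2 * treeSize A H` information sets have at
most `4 * A ^ H` actions, a constant multiple of the number of plans. -/
lemma mul_treeSize_le {A : ℕ} (hA : 2 ≤ A) (H : ℕ) : A * treeSize A H ≤ 2 * A ^ H := by
  obtain ⟨B, rfl⟩ : ∃ B, A = B + 1 := ⟨A - 1, by omega⟩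
  have h : (∑ i ∈ Finset.range H, (B + 1) ^ i) * B + 1 = (B + 1) ^ H := geom_sum_mul_add B H
  unfold treeSize
  set g := ∑ i ∈ Finset.range H, (B + 1) ^ i
  have : g * 1 ≤ g * B := Nat.mul_le_mul_left g (by omega)
  rw [← h]
  nlinarith

lemma InfoTree.HasFixedSize.numActions_eq {H A : ℕ} {I : InfoTree H} (h : I.HasFixedSize A) :
    I.numActions = A * I.numInfoSets := by
  rw [numActions, numInfoSets, Finset.sum_congr rfl fun x _ => h x]
  simp [mul_comm]

open PathTree

theorem exists_regret_variable (H : ℕ) [NeZero H] (T AX : ℕ) (δ : ℝ) (hAX : H ≤ AX) (hδ : 0 < δ)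
    (hδ' : δ < 1 / 4) (hT : 0.4 * ((AX / H : ℕ) : ℝ) * Real.log (1 / (4 * δ)) ≤ T)
    (L : MaxAlgorithm H) : ∃ (I J : InfoTree H) (G : Game I J), I.numActions = AX ∧
      ∀ N : G.Rule J, δ < G.prob (L.rule G) N T fun ω =>
        1 / 10000 * √(effSize AX H * T * Real.log (1 / (4 * δ))) ≤
          G.regretMax (L.rule G) N ω := by
  have hH : 0 < H := NeZero.pos H
  have hl := log_pos_of_lt hδ hδ'
  rcases hAX.eq_or_lt with rfl | hlt
  -- With `H` actions the tree is a single path: `effSize` vanishes and the only policy has regret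
  -- zero.
  · let S : BitSetup (pathTree (single H (H - 1) 1) 0) (pathTree (single H (H - 1) 1) 0) _ :=
      maxSetup (start := H - 1) (gap := 1 / 8) (by omega) (fun i => single_eq_one i)
        (by norm_num) (by norm_num)
    refine ⟨_, _, S.game none, ?_, fun N => ?_⟩
    · rw [numActions_single (by omega)]; omega
    · rw [Game.prob_eq_one]
      · linarith
      · intro ω
        have h0 : effSize H H = 0 := by simp [effSize]
        rw [h0, zero_mul, zero_mul, Real.sqrt_zero, mul_zero]
        refine le_trans (le_of_eq ?_) ((S.game none).le_regretMax _ _ _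
          (fun _ => Classical.choice inferInstance))
        refine (Finset.sum_eq_zero fun t _ => ?_).symm
        rw [sub_eq_zero]
        congr 1
        exact Subsingleton.elim _ _
  · obtain ⟨K, s, E, _, hK, hs, hcount, hKle, heff, -⟩ := exists_single AX hlt
    have hcard := card_plan_single hs K
    have hKle' : (K : ℝ) ≤ 2 * ((AX / H : ℕ) : ℝ) := by exact_mod_cast hKle
    obtain ⟨G, hG⟩ := exists_regret (c := single H s K) (c' := single H (H - 1) 1) (E := E)
      (E' := 0) (start := s) (T := T) hs (fun i => single_eq_one i) (by rw [hcard]; exact hK) hδ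
      hδ' (by rw [hcard]; nlinarith) L
    refine ⟨_, _, G, hcount, fun N => (hG N).trans_le (G.prob_mono _ _ fun ω hω => le_trans ?_ hω)⟩
    rw [hcard]
    have hd : 0 ≤ (H : ℝ) - s := sub_nonneg.2 (by exact_mod_cast hs.le)
    have hTl : 0 ≤ T * Real.log (1 / (4 * δ)) := by positivity
    calc 1 / 10000 * √(effSize AX H * T * Real.log (1 / (4 * δ)))
        ≤ 1 / 10000 * (2 * (((H : ℝ) - s) * √((K : ℝ) * T * Real.log (1 / (4 * δ))))) := by
          refine mul_le_mul_of_nonneg_left ?_ (by norm_num)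
          refine Real.sqrt_le_iff.2 ⟨by positivity, ?_⟩
          rw [mul_pow, mul_pow, Real.sq_sqrt (by positivity), mul_assoc (effSize AX H)]
          have h1 := mul_le_mul_of_nonneg_right heff hTl
          have h2 : 0 ≤ 2 * (K : ℝ) * ((H : ℝ) - s) ^ 2 * (T * Real.log (1 / (4 * δ))) := by
            positivity
          nlinarith
      _ ≤ _ := by
          have : 0 ≤ ((H : ℝ) - s) * √((K : ℝ) * T * Real.log (1 / (4 * δ))) := by positivity
          linarith

theorem exists_sample_variable (H : ℕ) [NeZero H] (AX BY : ℕ) (δ ε : ℝ) (hAX : H ≤ AX)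
    (hBY : H ≤ BY) (hδ : 0 < δ) (hδ' : δ < 1 / 4) (hε : 0 < ε)
    (hε' : ε ≤ min ((max AX BY : ℝ) - H) H / 8) (T : ℕ) (L : JointAlgorithm H) :
    ∃ (I J : InfoTree H) (G : Game I J), I.numActions = AX ∧ J.numActions = BY ∧
      (1 - δ ≤ L.successProb G T ε →
        1 / 10000 * ((effSize AX H + effSize BY H) / ε ^ 2 * Real.log (1 / (4 * δ))) ≤ T) := by
  have hl := log_pos_of_lt hδ hδ'
  have harith : ∀ {K d m m' : ℝ}, m ≤ 2 * K * d ^ 2 → m' ≤ m → 0 ≤ K →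
      1 / 10000 * ((m + m') / ε ^ 2 * Real.log (1 / (4 * δ))) ≤
        K * d ^ 2 * Real.log (1 / (4 * δ)) / (600 * ε ^ 2) := by
    intro K d m m' h1 h2 hK
    have h3 : m + m' ≤ 4 * (K * d ^ 2) := by linarith
    calc 1 / 10000 * ((m + m') / ε ^ 2 * Real.log (1 / (4 * δ)))
        ≤ 1 / 10000 * (4 * (K * d ^ 2) / ε ^ 2 * Real.log (1 / (4 * δ))) := by gcongr
      _ = 4 / 10000 * (K * d ^ 2 * Real.log (1 / (4 * δ)) / ε ^ 2) := by ring
      _ ≤ 1 / 600 * (K * d ^ 2 * Real.log (1 / (4 * δ)) / ε ^ 2) :=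
          mul_le_mul_of_nonneg_right (by norm_num) (by positivity)
      _ = _ := by field_simp
  -- A positive `ε` below the bound excludes that both players are without choices.
  have hlt : H < max AX BY := by
    by_contra hcon
    have h1 : max (AX : ℝ) BY ≤ H := by exact_mod_cast not_lt.1 hcon
    have := min_le_left ((max AX BY : ℝ) - H) H
    linarith
  -- The player with more actions carries the arms; by monotonicity of `effSize` the sum of both
  -- terms is at most twice the larger one.
  rcases le_total BY AX with hle | hle
  · rw [max_eq_left hle] at hlt
    rw [max_eq_left (by exact_mod_cast hle)] at hε'
    obtain ⟨K, s, E, _, hK, hs, hcount, -, heff, hmin⟩ := exists_single AX hlt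
    obtain ⟨K', _, hcount'⟩ := exists_numActions BY hBY
    obtain ⟨G, hG⟩ := exists_sample (c := single H s K) (c' := single H (H - 1) K') (E := E)
      (E' := 0) K hs hK (Or.inl ⟨fun i => single_eq_one i, card_plan_single hs K⟩) hδ hδ' hε
      (by linarith) T L
    exact ⟨_, _, G, hcount, hcount', fun h =>
      (harith heff (effSize_mono hBY hle) (Nat.cast_nonneg K)).trans (hG h)⟩
  · rw [max_eq_right hle] at hlt
    rw [max_eq_right (by exact_mod_cast hle)] at hε'
    obtain ⟨K, s, E, _, hK, hs, hcount, -, heff, hmin⟩ := exists_single BY hlt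
    obtain ⟨K', _, hcount'⟩ := exists_numActions AX hAX
    obtain ⟨G, hG⟩ := exists_sample (c := single H (H - 1) K') (c' := single H s K) (E := 0)
      (E' := E) K hs hK (Or.inr ⟨fun i => single_eq_one i, card_plan_single hs K⟩) hδ hδ' hε
      (by linarith) T L
    refine ⟨_, _, G, hcount', hcount, fun h => ?_⟩
    rw [add_comm (effSize AX H)]
    exact (harith heff (effSize_mono hAX hle) (Nat.cast_nonneg K)).trans (hG h)

lemma numActions_constant_le {H A X : ℕ} [NeZero H] [NeZero A] (hA : 2 ≤ A)
    (hX : treeSize A H ≤ X) (hX' : X < 2 * treeSize A H) :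
    (pathTree (constant H A) (X - treeSize A H)).numInfoSets = X ∧
      ((pathTree (constant H A) (X - treeSize A H)).numActions : ℝ) ≤ 4 * (A : ℝ) ^ H := by
  have h1 : (pathTree (constant H A) (X - treeSize A H)).numInfoSets = X := by
    rw [numInfoSets_constant]; omega
  refine ⟨h1, ?_⟩
  rw [(hasFixedSize_constant A).numActions_eq, h1]
  have h2 := mul_treeSize_le hA H
  have h3 := Nat.mul_le_mul_left A hX'.le
  have h4 : A * X ≤ 4 * A ^ H := by
    rw [mul_left_comm] at h3
    linarith
  exact_mod_cast h4

lemma two_le_pow {A H : ℕ} [NeZero H] (hA : 2 ≤ A) : 2 ≤ A ^ H :=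
  hA.trans (Nat.le_self_pow (NeZero.ne H) A)

theorem exists_regret_fixed (H : ℕ) [NeZero H] (T A X : ℕ) (δ : ℝ) (hA : 2 ≤ A)
    (hX : treeSize A H ≤ X) (hX' : X < 2 * treeSize A H) (hδ : 0 < δ) (hδ' : δ < 1 / 4)
    (hT : 0.4 * (2 * (A : ℝ) ^ H) * Real.log (1 / (4 * δ)) ≤ T) (L : MaxAlgorithm H) :
    ∃ (I J : InfoTree H) (G : Game I J), I.HasFixedSize A ∧ I.numInfoSets = X ∧
      ∀ N : G.Rule J, δ < G.prob (L.rule G) N T fun ω =>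
        1 / 10000 * √(T * (I.numActions : ℝ) * Real.log (1 / (4 * δ))) ≤
          G.regretMax (L.rule G) N ω := by
  have hH : 0 < H := NeZero.pos H
  have hl := log_pos_of_lt hδ hδ'
  have : NeZero A := ⟨by omega⟩
  obtain ⟨hcount, hact⟩ := numActions_constant_le (H := H) hA hX hX'
  have hcard := card_plan_constant (H := H) A
  have hA0 : (0 : ℝ) < (A : ℝ) ^ H := by positivity
  -- Every step has a choice, so the arm is settled only at the last step, which alone is rewarded.
  obtain ⟨G, hG⟩ := exists_regret (c := constant H A) (c' := single H (H - 1) 1)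
    (E := X - treeSize A H) (E' := 0) (start := H - 1) (T := T) (by omega)
    (fun i hi => by have := i.2; omega) (by rw [hcard]; exact two_le_pow hA) hδ hδ'
    (by rw [hcard]; push_cast; nlinarith [mul_pos hA0 hl]) L
  refine ⟨_, _, G, hasFixedSize_constant A, hcount,
    fun N => (hG N).trans_le (G.prob_mono _ _ fun ω hω => le_trans ?_ hω)⟩
  have hd : (H : ℝ) - (H - 1 : ℕ) = 1 := by rw [Nat.cast_sub hH]; simp
  rw [hcard, hd, one_mul]
  push_cast
  have hTl : 0 ≤ T * Real.log (1 / (4 * δ)) := by positivity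
  have h1 : √(T * ((pathTree (constant H A) (X - treeSize A H)).numActions : ℝ) *
      Real.log (1 / (4 * δ))) ≤ 2 * √((A : ℝ) ^ H * T * Real.log (1 / (4 * δ))) := by
    refine Real.sqrt_le_iff.2 ⟨by positivity, ?_⟩
    rw [mul_pow, Real.sq_sqrt (by positivity)]
    have := mul_le_mul_of_nonneg_right hact hTl
    nlinarith
  have h2 := Real.sqrt_nonneg ((A : ℝ) ^ H * T * Real.log (1 / (4 * δ)))
  linarith

theorem exists_sample_fixed (H : ℕ) [NeZero H] (A B X Y : ℕ) (δ ε : ℝ) (hA : 2 ≤ A) (hB : 2 ≤ B)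
    (hX : treeSize A H ≤ X) (hX' : X < 2 * treeSize A H) (hY : treeSize B H ≤ Y)
    (hY' : Y < 2 * treeSize B H) (hδ : 0 < δ) (hδ' : δ < 1 / 4) (hε : 0 < ε) (hε' : ε ≤ 1 / 8)
    (T : ℕ) (L : JointAlgorithm H) : ∃ (I J : InfoTree H) (G : Game I J),
      I.HasFixedSize A ∧ I.numInfoSets = X ∧ J.HasFixedSize B ∧ J.numInfoSets = Y ∧
      (1 - δ ≤ L.successProb G T ε →
        1 / 10000 * (((I.numActions : ℝ) + J.numActions) / ε ^ 2 * Real.log (1 / (4 * δ))) ≤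
          T) := by
  have hH : 0 < H := NeZero.pos H
  have hl := log_pos_of_lt hδ hδ'
  have : NeZero A := ⟨by omega⟩
  have : NeZero B := ⟨by omega⟩
  obtain ⟨hcount, hact⟩ := numActions_constant_le (H := H) hA hX hX'
  obtain ⟨hcount', hact'⟩ := numActions_constant_le (H := H) hB hY hY'
  have hd : (H : ℝ) - (H - 1 : ℕ) = 1 := by rw [Nat.cast_sub hH]; simp
  have hlast : ∀ (c : Fin H → ℕ) (i : Fin H), H - 1 < i.1 → c i = 1 := fun c i hi => by
    have := i.2; omega
  -- The arms are the plans of the player who has more of them.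
  have hcard : ((∀ i : Fin H, H - 1 < i.1 → constant H A i = 1) ∧
      Fintype.card (Plan (constant H A)) = max (A ^ H) (B ^ H)) ∨
      ((∀ i : Fin H, H - 1 < i.1 → constant H B i = 1) ∧
        Fintype.card (Plan (constant H B)) = max (A ^ H) (B ^ H)) := by
    rcases le_total (A ^ H) (B ^ H) with h | h
    · exact Or.inr ⟨hlast _, by rw [card_plan_constant, max_eq_right h]⟩
    · exact Or.inl ⟨hlast _, by rw [card_plan_constant, max_eq_left h]⟩
  obtain ⟨G, hG⟩ := exists_sample (c := constant H A) (c' := constant H B)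
    (E := X - treeSize A H) (E' := Y - treeSize B H) (start := H - 1) (max (A ^ H) (B ^ H))
    (by omega) ((two_le_pow hA).trans (le_max_left _ _)) hcard hδ hδ' hε
    (by rw [hd]; exact hε') T L
  refine ⟨_, _, G, hasFixedSize_constant A, hcount, hasFixedSize_constant B, hcount',
    fun h => le_trans ?_ (hG h)⟩
  rw [hd]
  push_cast
  set K : ℝ := max ((A : ℝ) ^ H) ((B : ℝ) ^ H) with hK
  have hKA : (A : ℝ) ^ H ≤ K := le_max_left _ _
  have hKB : (B : ℝ) ^ H ≤ K := le_max_right _ _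
  have hK0 : 0 ≤ K := le_trans (by positivity) hKA
  calc _ ≤ 1 / 10000 * (8 * K / ε ^ 2 * Real.log (1 / (4 * δ))) := by
        gcongr
        linarith
    _ = 8 / 10000 * (K * Real.log (1 / (4 * δ)) / ε ^ 2) := by ring
    _ ≤ 1 / 600 * (K * Real.log (1 / (4 * δ)) / ε ^ 2) :=
        mul_le_mul_of_nonneg_right (by norm_num) (by positivity)
    _ = _ := by field_simp

end

theorem theorem2 :
    -- no game has fewer actions or information sets than these
    (∀ (H : ℕ) [NeZero H] (I J : InfoTree H), Nonempty (Game I J) →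
      H ≤ I.numActions ∧ H ≤ J.numActions) ∧
    (∀ (H A : ℕ) [NeZero H] (I J : InfoTree H), Nonempty (Game I J) → 2 ≤ A →
      (I.HasFixedSize A → treeSize A H ≤ I.numInfoSets) ∧
      (J.HasFixedSize A → treeSize A H ≤ J.numInfoSets)) ∧
    ∃ c : ℝ, 0 < c ∧
      -- regret, variable action-set sizes
      (∀ (H : ℕ) [NeZero H] (T AX : ℕ) (δ : ℝ), H ≤ AX → 0 < δ → δ < 1 / 4 →
        0.4 * ((AX / H : ℕ) : ℝ) * Real.log (1 / (4 * δ)) ≤ T →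
        ∀ L : MaxAlgorithm H, ∃ (I J : InfoTree H) (G : Game I J), I.numActions = AX ∧
          ∀ N : G.Rule J, δ < G.prob (L.rule G) N T fun ω =>
            c * √(effSize AX H * T * Real.log (1 / (4 * δ))) ≤ G.regretMax (L.rule G) N ω) ∧
      -- sample complexity, variable action-set sizes
      (∀ (H : ℕ) [NeZero H] (AX BY : ℕ) (δ ε : ℝ), H ≤ AX → H ≤ BY → 0 < δ → δ < 1 / 4 →
        0 < ε → ε ≤ min ((max AX BY : ℝ) - H) H / 8 →
        ∀ (T : ℕ) (L : JointAlgorithm H), ∃ (I J : InfoTree H) (G : Game I J),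
          I.numActions = AX ∧ J.numActions = BY ∧
          (1 - δ ≤ L.successProb G T ε →
            c * ((effSize AX H + effSize BY H) / ε ^ 2 * Real.log (1 / (4 * δ))) ≤ T)) ∧
      -- regret, fixed action-set size
      (∀ (H : ℕ) [NeZero H] (T A X : ℕ) (δ : ℝ), 2 ≤ A →
        treeSize A H ≤ X → X < 2 * treeSize A H → 0 < δ → δ < 1 / 4 →
        0.4 * (2 * (A : ℝ) ^ H) * Real.log (1 / (4 * δ)) ≤ T →
        ∀ L : MaxAlgorithm H, ∃ (I J : InfoTree H) (G : Game I J),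
          I.HasFixedSize A ∧ I.numInfoSets = X ∧
          ∀ N : G.Rule J, δ < G.prob (L.rule G) N T fun ω =>
            c * √(T * (I.numActions : ℝ) * Real.log (1 / (4 * δ))) ≤
              G.regretMax (L.rule G) N ω) ∧
      -- sample complexity, fixed action-set sizes
      (∀ (H : ℕ) [NeZero H] (A B X Y : ℕ) (δ ε : ℝ), 2 ≤ A → 2 ≤ B →
        treeSize A H ≤ X → X < 2 * treeSize A H → treeSize B H ≤ Y → Y < 2 * treeSize B H →
        0 < δ → δ < 1 / 4 → 0 < ε → ε ≤ 1 / 8 →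
        ∀ (T : ℕ) (L : JointAlgorithm H), ∃ (I J : InfoTree H) (G : Game I J),
          I.HasFixedSize A ∧ I.numInfoSets = X ∧ J.HasFixedSize B ∧ J.numInfoSets = Y ∧
          (1 - δ ≤ L.successProb G T ε →
            c * (((I.numActions : ℝ) + J.numActions) / ε ^ 2 * Real.log (1 / (4 * δ))) ≤ T)) := by
  refine ⟨fun H _ I J ⟨G⟩ => le_numActions G, fun H A _ I J ⟨G⟩ _ =>
    ⟨fun h => G.treeSize_le_left fun x => (h x).ge, fun h => G.treeSize_le_right fun y => (h y).ge⟩,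
    1 / 10000, by norm_num, exists_regret_variable, exists_sample_variable, exists_regret_fixed,
    exists_sample_fixed⟩
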